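/- For a permutation $\pi$ of $\{1,\dots,n\}$, an occurrence of a pattern $\tau\in\mathfrak S_m$ in $\pi$ is a sequence of positions $i_1<\dots<i_m$ such that $(\pi_{i_1},\dots,\pi_{i_m})$ is order-isomorphic to $\tau$; $\pi$ avoids $\tau$ if there is none. A permutation is even if its number of inversions is even. For $k\ge 2$ let $J^e_{12\dots k}(n)$ be the number of even involutions $\pi=\pi^{-1}\in\mathfrak S_n$ that contain exactly one occurrence of the pattern $132$ and avoid the pattern $12\dots k$, and let $J^e_{12\dots k}(x)=\sum_{n\ge 0}J^e_{12\dots k}(n)\,x^n$. Let $U_r$ denote the Chebyshev polynomials of the second kind ($U_0(t)=1$, $U_1(t)=2t$, $U_r(t)=2tU_{r-1}(t)-U_{r-2}(t)$), and put $$R_m(x)=\frac{U_{m-1}\left(\frac{1}{2\sqrt{x}}\right)}{\sqrt{x}\,U_m\left(\frac{1}{2\sqrt{x}}\right)}\quad(m\ge 1),\qquad R^e_m(x)=\tfrac12\bigl(R_m(x)+R_m(-x)\bigr),\qquad R^o_m(x)=\tfrac12\bigl(R_m(x)-R_m(-x)\bigr);$$ the $R_m$ are rational functions of $x$. **Theorem.**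 For all $k\ge 2$, as formal Laurent series in $x$, $$J^e_{12\dots k}(x)=\sum_{j=3}^{k}\left(x^{k+3-j}\left[R^o_{j-1}(x^2)+\frac{R^e_{j-1}(x^2)}{U_j\left(\frac{1}{2x}\right)}\sum_{i=1}^{j-2}U_i\left(\frac{1}{2x}\right)\right]\prod_{i=j}^{k}R_i(-x^2)\right).$$ In particular $J^e_{12}(x)=0$ (empty sum). -/

import Mathlib

open scoped PowerSeries LaurentSeries

/-! Permutations of `{1, …, n}` are `Equiv.Perm (Fin n)`. -/

/-- The inversions of `π`: pairs of positions `i < j` with `π j < π i`. -/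
def inversions {n : ℕ} (π : Equiv.Perm (Fin n)) : Finset (Fin n × Fin n) :=
  {p | p.1 < p.2 ∧ π p.2 < π p.1}

/-- A permutation is even when it has an even number of inversions. -/
def IsEvenPerm {n : ℕ} (π : Equiv.Perm (Fin n)) : Prop :=
  Even (inversions π).card

/-- The occurrences of the pattern `τ` in `π`: choices of positions `f 0 < f 1 < ⋯ < f (k-1)`
such that `π (f 0), …, π (f (k-1))` is order-isomorphic to `τ`. -/
def occurrences {k n : ℕ} (τ : Equiv.Perm (Fin k)) (π : Equiv.Perm (Fin n)) :
    Set (Fin k ↪o Fin n) :=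
  {f | ∀ a b : Fin k, π (f a) < π (f b) ↔ τ a < τ b}

/-- `π` avoids `τ`. -/
def Avoids {k n : ℕ} (τ : Equiv.Perm (Fin k)) (π : Equiv.Perm (Fin n)) : Prop :=
  occurrences τ π = ∅

/-- The pattern `132`. -/
def pattern132 : Equiv.Perm (Fin 3) := Equiv.swap 1 2

/-- The increasing pattern `12…k`. -/
def increasingPattern (k : ℕ) : Equiv.Perm (Fin k) := 1

/-- The even involutions of `n` letters that contain `132` exactly once and avoid `τ`. -/
def evenInvolutionsOnce132 {k : ℕ} (τ : Equiv.Perm (Fin k)) (n : ℕ) :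
    Set (Equiv.Perm (Fin n)) :=
  {π | π⁻¹ = π ∧ IsEvenPerm π ∧ (occurrences pattern132 π).ncard = 1 ∧ Avoids τ π}

/-- The generating function `∑ₙ Jᵉ_τ(n) xⁿ`, where `Jᵉ_τ(n)` is the number of even involutions of
`n` letters that contain `132` exactly once and avoid `τ`. -/
noncomputable def genJe {k : ℕ} (τ : Equiv.Perm (Fin k)) : ℂ⟦X⟧ :=
  PowerSeries.mk fun n => ((evenInvolutionsOnce132 τ n).ncard : ℂ)

/-- The value `U_r(t)` of the Chebyshev polynomial of the second kind at an element of a field. -/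
noncomputable def chebU {K : Type*} [Field K] (r : ℕ) (t : K) : K :=
  (Polynomial.Chebyshev.U K (r : ℤ)).eval t

/-- `U_{k-1}(1/(2s)) / (s U_k(1/(2s)))`, where `U_{-1} = 0`. -/
noncomputable def chebQuotient {K : Type*} [Field K] (k : ℕ) (s : K) : K :=
  (Polynomial.Chebyshev.U K ((k : ℤ) - 1)).eval (1 / (2 * s)) / (s * chebU k (1 / (2 * s)))

open Classical in
/-- `R_k(t) = U_{k-1}(1/(2√t)) / (√t U_k(1/(2√t)))` for every `t` that is a square in the field
(both square roots give the same value, see `chebR_sq`); `0` for the other `t`. -/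
noncomputable def chebR {K : Type*} [Field K] (k : ℕ) (t : K) : K :=
  if h : ∃ s : K, s ^ 2 = t then chebQuotient k h.choose else 0

theorem chebQuotient_neg {K : Type*} [Field K] (k : ℕ) (s : K) :
    chebQuotient k (-s) = chebQuotient k s := by
  have h : (1 : K) / (2 * -s) = -(1 / (2 * s)) := by
    rw [mul_neg, div_neg]
  unfold chebQuotient chebU
  rw [h]
  cases k with
  | zero => simp
  | succ m =>
    have e : (((m + 1 : ℕ) : ℤ) - 1) = (m : ℤ) := by push_cast; ring
    rw [e, Polynomial.Chebyshev.U_eval_neg, Polynomial.Chebyshev.U_eval_neg]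
    push_cast
    rw [Int.negOnePow_succ]
    rcases Int.units_eq_one_or ((m : ℤ).negOnePow) with e | e <;> rw [e] <;> simp [neg_div, div_neg]

theorem chebR_sq {K : Type*} [Field K] (k : ℕ) (s : K) :
    chebR k (s ^ 2) = chebQuotient k s := by
  have h : ∃ u : K, u ^ 2 = s ^ 2 := ⟨s, rfl⟩
  rw [chebR, dif_pos h]
  rcases sq_eq_sq_iff_eq_or_eq_neg.mp h.choose_spec with h1 | h1
  · rw [h1]
  · rw [h1, chebQuotient_neg]

/-- `Rᵉ_k(t) = (R_k(t) + R_k(-t)) / 2`. -/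
noncomputable def chebRe {K : Type*} [Field K] (k : ℕ) (t : K) : K :=
  (1 / 2) * (chebR k t + chebR k (-t))

/-- `Rᵒ_k(t) = (R_k(t) - R_k(-t)) / 2`. -/
noncomputable def chebRo {K : Type*} [Field K] (k : ℕ) (t : K) : K :=
  (1 / 2) * (chebR k t - chebR k (-t))

/-- The variable `x` as a formal Laurent series. -/
noncomputable def laurentX : LaurentSeries ℂ := ((PowerSeries.X : ℂ⟦X⟧) : LaurentSeries ℂ)

/-- In the field of formal Laurent series `-x²` is a square as well. -/
theorem neg_laurentX_sq :
    -laurentX ^ 2 = (HahnSeries.C Complex.I * laurentX) ^ 2 := by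
  rw [mul_pow, ← map_pow, Complex.I_sq, map_neg, map_one, neg_one_mul]

open Equiv Finset

/-! Let the largest entry of `π`, an involution with exactly one `132`, stand at position `a`. There
are three cases. If it is last, it is a fixed point and can be deleted (`extTop`). Otherwise, if the
first `a` entries exceed all later ones, then `π = ρ ⊖ σ ⊖ ρ⁻¹`, where `ρ` avoids `132` and ends in
its maximum and `σ` is again an involution with one `132` (`exists_sandwich`). If not, the largest
entry is the `3` of the occurrence. Uniqueness together with `π = π⁻¹` then determines the
occurrence (`TopAt.not_split`), and `π` arises from `ρ ⊖ 1 ⊖ ρ⁻¹` by conjugating with one adjacent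
transposition (`exists_pivotGlue`).

Evenness is extracted by averaging the trivial and the sign character. For a character with value
`s` at `-1`, let `A k` be the weighted generating function of the involutions without an increasing
subsequence of length `k`, and `D k` that of all `132`-avoiders with the same restriction, taken at
`s x²`. The cases give `A (k+1) = x A k + s x² D k A (k+1) + s x³ D k` (`onceGF_succ`). Splitting
`132`-avoiders at their largest entry gives `D (k+1) = 1 + s x² D k D (k+1)`, which is the Chebyshev
recurrence in disguise, so `D k = R_k(s x²)` (`chebQuotient_eq`). Hence `A (k+1) = D (k+1) (x A k +
s x³ D k)`.

For `s = 1` multiplication by `U_k` turns this into a telescoping sum (`mul_chebU_eq_sum`). The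
average of the two characters can then be made to satisfy a recurrence with the single factor
`R_{k+1}(-x²)` (`average_recurrence`). Unrolling it from `k = 2`, where nothing is counted, gives
the formula. -/

/-- The occurrences of `132` as triples of positions. -/
def occ132 {n : ℕ} (π : Perm (Fin n)) : Finset (Fin n × Fin n × Fin n) :=
  {t | t.1 < t.2.1 ∧ t.2.1 < t.2.2 ∧ π t.1 < π t.2.2 ∧ π t.2.2 < π t.2.1}

/-- All increasing subsequences of `π` are shorter than `k`. -/
def LISLt {n : ℕ} (k : ℕ) (π : Perm (Fin n)) : Prop :=
  ∀ s : Finset (Fin n), StrictMonoOn π s → s.card < k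

/-- The largest value of `π` is its `a`-th entry, counted from one. -/
def TopAt {n : ℕ} (a : ℕ) (π : Perm (Fin n)) : Prop :=
  ∃ i : Fin n, (i : ℕ) + 1 = a ∧ (π i : ℕ) + 1 = n

/-- Each of the first `a` entries of `π` exceeds all later ones. -/
def Split {n : ℕ} (a : ℕ) (π : Perm (Fin n)) : Prop :=
  ∀ i j : Fin n, (i : ℕ) < a → a ≤ (j : ℕ) → π j < π i

/-! ### Occurrences of 132, increasing subsequences and signs. -/

theorem mem_occ132 {n : ℕ} {π : Perm (Fin n)} {x y z : Fin n} :
    (x, y, z) ∈ occ132 π ↔ x < y ∧ y < z ∧ π x < π z ∧ π z < π y := by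
  simp [occ132]

/-- The pattern `132` is its own inverse: reading an occurrence by values exchanges the roles of its
last two points. -/
theorem card_occ132_inv {n : ℕ} (π : Perm (Fin n)) :
    (occ132 π⁻¹).card = (occ132 π).card := by
  symm
  refine Finset.card_bij' (fun t _ => (π t.1, π t.2.2, π t.2.1))
    (fun t _ => (π⁻¹ t.1, π⁻¹ t.2.2, π⁻¹ t.2.1)) ?_ ?_ ?_ ?_
  · rintro ⟨x, y, z⟩ h
    rw [mem_occ132] at h
    simp [mem_occ132, h]
  · rintro ⟨x, y, z⟩ h
    rw [mem_occ132] at h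
    simpa [mem_occ132, h.1, h.2.1] using h.2.2
  · rintro ⟨x, y, z⟩ h
    simp
  · rintro ⟨x, y, z⟩ h
    simp

theorem LISLt.inv {n k : ℕ} {π : Perm (Fin n)} (h : LISLt k π) : LISLt k π⁻¹ := by
  intro s hs
  have := h (s.map (π⁻¹).toEmbedding) ?_
  · simpa using this
  · intro x hx y hy hxy
    simp only [coe_map, Set.mem_image, mem_coe, Equiv.coe_toEmbedding] at hx hy
    obtain ⟨x, hx, rfl⟩ := hx
    obtain ⟨y, hy, rfl⟩ := hy
    have := (hs.lt_iff_lt hx hy).1 hxy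
    simpa using this

theorem lisLt_inv {n k : ℕ} {π : Perm (Fin n)} : LISLt k π⁻¹ ↔ LISLt k π :=
  ⟨fun h => by simpa using h.inv, LISLt.inv⟩

theorem avoids_increasingPattern_iff {n k : ℕ} (π : Perm (Fin n)) :
    Avoids (increasingPattern k) π ↔ LISLt k π := by
  unfold Avoids occurrences increasingPattern
  rw [Set.eq_empty_iff_forall_notMem]
  constructor
  · intro h s hs
    by_contra! hk
    obtain ⟨t, hts, ht⟩ := Finset.exists_subset_card_eq hk
    refine h (t.orderEmbOfFin ht) fun a b => ?_
    rw [hs.lt_iff_lt (hts (t.orderEmbOfFin_mem ht a)) (hts (t.orderEmbOfFin_mem ht b))]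
    simp
  · intro h f hf
    have := h (Finset.univ.map f.toEmbedding) ?_
    · simp at this
    · intro x hx y hy hxy
      simp only [coe_map, Set.mem_image, mem_coe] at hx hy
      obtain ⟨x, hx, rfl⟩ := hx
      obtain ⟨y, hy, rfl⟩ := hy
      exact (hf x y).2 (f.lt_iff_lt.1 hxy)

theorem ncard_occurrences_pattern132 {n : ℕ} (π : Perm (Fin n)) :
    (occurrences pattern132 π).ncard = (occ132 π).card := by
  rw [← Set.ncard_coe_finset]
  refine Set.ncard_congr (fun f _ => (f 0, f 1, f 2)) ?_ ?_ ?_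
  · intro f hf
    simp only [mem_coe, mem_occ132, f.lt_iff_lt]
    refine ⟨by decide, by decide, (hf 0 2).2 (by decide), (hf 2 1).2 (by decide)⟩
  · intro f g _ _ h
    simp only [Prod.mk.injEq] at h
    ext i
    fin_cases i <;> simp [h]
  · rintro ⟨x, y, z⟩ h
    simp only [mem_coe, mem_occ132] at h
    obtain ⟨h1, h2, h3, h4⟩ := h
    refine ⟨OrderEmbedding.ofStrictMono ![x, y, z] ?_, ?_, ?_⟩
    · rw [Fin.strictMono_iff_lt_succ]
      intro i
      fin_cases i <;> simpa
    · have e0 : pattern132 0 = 0 := by decide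
      have e1 : pattern132 1 = 2 := by decide
      have e2 : pattern132 2 = 1 := by decide
      intro a b
      fin_cases a <;> fin_cases b <;> simp [e0, e1, e2] <;> first | assumption | order
    · simp

theorem sign_eq_neg_one_pow_card_inversions {n : ℕ} (π : Perm (Fin n)) :
    Perm.sign π = (-1) ^ (inversions π).card := by
  rw [Perm.sign_eq_prod_prod_Ioi, ← Finset.prod_const, inversions, Finset.prod_filter,
    Fintype.prod_prod_type]
  refine Finset.prod_congr rfl fun i _ => ?_
  have : Ioi i = Finset.univ.filter (i < ·) := by ext; simp
  rw [this, Finset.prod_filter]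
  refine Finset.prod_congr rfl fun j _ => ?_
  by_cases hij : i < j
  · rcases lt_or_gt_of_ne (π.injective.ne hij.ne) with h | h <;> simp [hij, h, h.not_gt]
  · simp [hij]

theorem isEvenPerm_iff {n : ℕ} (π : Perm (Fin n)) : IsEvenPerm π ↔ Perm.sign π = 1 := by
  rw [sign_eq_neg_one_pow_card_inversions, IsEvenPerm]
  rw [neg_one_pow_eq_one_iff_even (by decide)]

/-! ### Adding a largest last entry -/

/-- `π` followed by a new largest entry. -/
def extTop {n : ℕ} (π : Perm (Fin n)) : Perm (Fin (n + 1)) :=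
  finSumFinEquiv.permCongr (Equiv.sumCongr π (1 : Perm (Fin 1)))

@[simp] theorem extTop_castSucc {n : ℕ} (π : Perm (Fin n)) (i : Fin n) :
    extTop π i.castSucc = (π i).castSucc := by
  have : i.castSucc = finSumFinEquiv (Sum.inl i : Fin n ⊕ Fin 1) := rfl
  rw [extTop, Equiv.permCongr_apply, this, Equiv.symm_apply_apply]
  rfl

@[simp] theorem extTop_last {n : ℕ} (π : Perm (Fin n)) :
    extTop π (Fin.last n) = Fin.last n := by
  have : Fin.last n = finSumFinEquiv (Sum.inr 0 : Fin n ⊕ Fin 1) := rfl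
  rw [extTop, Equiv.permCongr_apply, this, Equiv.symm_apply_apply]
  rfl

@[simp] theorem sign_extTop {n : ℕ} (π : Perm (Fin n)) :
    Perm.sign (extTop π) = Perm.sign π := by
  rw [extTop, Perm.sign_permCongr]
  exact (Perm.sign_sumCongr π 1).trans (by simp)

theorem extTop_injective {n : ℕ} : Function.Injective (extTop (n := n)) := by
  intro π ρ h
  ext i
  have := congrArg (fun σ : Perm (Fin (n + 1)) => (σ i.castSucc : ℕ)) h
  simpa using this

theorem inv_extTop {n : ℕ} (π : Perm (Fin n)) : (extTop π)⁻¹ = extTop π⁻¹ := by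
  rw [inv_eq_iff_mul_eq_one]
  ext i
  induction i using Fin.lastCases <;> simp

theorem topAt_extTop {n : ℕ} (π : Perm (Fin n)) : TopAt (n + 1) (extTop π) :=
  ⟨Fin.last n, by simp⟩

theorem TopAt.exists_extTop {n : ℕ} {π : Perm (Fin (n + 1))} (h : TopAt (n + 1) π) :
    ∃ ρ, π = extTop ρ := by
  obtain ⟨i, hi, hπ⟩ := h
  have e1 : i = Fin.last n := Fin.ext (by simpa using hi)
  have e2 : π (Fin.last n) = Fin.last n := Fin.ext (by rw [e1] at hπ; simpa using hπ)
  have key : ∀ i : Fin n, ∃ j : Fin n, π i.castSucc = j.castSucc := by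
    intro i
    obtain ⟨j, hj⟩ | h := Fin.eq_castSucc_or_eq_last (π i.castSucc)
    · exact ⟨j, hj⟩
    · exact absurd (π.injective (h.trans e2.symm)) (Fin.castSucc_ne_last i)
  choose f hf using key
  have inj : Function.Injective f := fun x y hxy => by
    have := (hf x).trans ((congrArg _ hxy).trans (hf y).symm)
    simpa using this
  refine ⟨Equiv.ofBijective f (Finite.injective_iff_bijective.1 inj), ?_⟩
  ext i
  induction i using Fin.lastCases with
  | last => simp [e2]
  | cast i => simp [hf]

/-- A maximum in last position could only be the final letter of an occurrence, and the final letter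
of `132` is not its largest. -/
theorem card_occ132_extTop {n : ℕ} (π : Perm (Fin n)) :
    (occ132 (extTop π)).card = (occ132 π).card := by
  symm
  refine Finset.card_bij (fun t _ => (t.1.castSucc, t.2.1.castSucc, t.2.2.castSucc)) ?_ ?_ ?_
  · rintro ⟨x, y, z⟩ h
    simpa [mem_occ132] using h
  · rintro ⟨x, y, z⟩ _ ⟨x', y', z'⟩ _ h
    simpa using h
  · rintro ⟨x, y, z⟩ h
    rw [mem_occ132] at h
    induction z using Fin.lastCases with
    | last =>
      rw [extTop_last] at h
      exact absurd h.2.2.2 (Fin.le_last _).not_gt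
    | cast z =>
      induction y using Fin.lastCases with
      | last => exact absurd h.2.1 (Fin.le_last _).not_gt
      | cast y =>
        induction x using Fin.lastCases with
        | last => exact absurd h.1 (Fin.le_last _).not_gt
        | cast x =>
          exact ⟨(x, y, z), by simpa [mem_occ132] using h, rfl⟩

theorem lisLt_extTop {n k : ℕ} (π : Perm (Fin n)) : LISLt (k + 1) (extTop π) ↔ LISLt k π := by
  constructor
  · intro h s hs
    have := h (insert (Fin.last n) (s.map Fin.castSuccEmb)) ?_
    · rw [Finset.card_insert_of_notMem (by simp), Finset.card_map] at this
      omega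
    · intro x hx y hy hxy
      simp only [coe_insert, coe_map, Set.mem_insert_iff, Set.mem_image, mem_coe] at hx hy
      rcases hx with rfl | ⟨x, hx, rfl⟩
      · exact absurd hxy (Fin.le_last _).not_gt
      · rcases hy with rfl | ⟨y, hy, rfl⟩
        · simp [Fin.castSucc_lt_last]
        · simpa using hs hx hy (by simpa using hxy)
  · intro h s hs
    have h1 := h (s.preimage Fin.castSucc (Fin.castSucc_injective n).injOn) ?_
    · have : s ⊆ insert (Fin.last n) ((s.preimage Fin.castSucc
          (Fin.castSucc_injective n).injOn).map Fin.castSuccEmb) := by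
        intro x hx
        induction x using Fin.lastCases with
        | last => simp
        | cast x => simp [hx]
      have := Finset.card_le_card this
      have h2 := Finset.card_insert_le (Fin.last n) ((s.preimage Fin.castSucc
          (Fin.castSucc_injective n).injOn).map Fin.castSuccEmb)
      rw [Finset.card_map] at h2
      omega
    · intro x hx y hy hxy
      simp only [coe_preimage, Set.mem_preimage, mem_coe] at hx hy
      simpa using hs hx hy (by simpa using hxy)

/-! ### Skew sums -/

/-- The skew sum: the entries of `ρ`, raised by `b`, followed by those of `σ`. -/
def skewSum {a b : ℕ} (ρ : Perm (Fin a)) (σ : Perm (Fin b)) : Perm (Fin (a + b)) :=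
  finSumFinEquiv.symm.trans ((Equiv.sumCongr ρ σ).trans ((Equiv.sumComm _ _).trans
    (finSumFinEquiv.trans (finCongr (add_comm b a)))))

section
variable {a b : ℕ} (ρ : Perm (Fin a)) (σ : Perm (Fin b))

theorem skewSum_castAdd (i : Fin a) : (skewSum ρ σ (Fin.castAdd b i) : ℕ) = b + ρ i := by
  simp [skewSum, add_comm]

theorem skewSum_natAdd (i : Fin b) : (skewSum ρ σ (Fin.natAdd a i) : ℕ) = σ i := by
  simp [skewSum]

theorem split_skewSum : Split a (skewSum ρ σ) := by
  intro i j hi hj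
  induction i using Fin.addCases with
  | right i => simp at hi
  | left i =>
    induction j using Fin.addCases with
    | left j => simp at hj; omega
    | right j =>
      rw [Fin.lt_def, skewSum_castAdd, skewSum_natAdd]
      omega

theorem skewSum_injective {ρ ρ' : Perm (Fin a)} {σ σ' : Perm (Fin b)}
    (h : skewSum ρ σ = skewSum ρ' σ') : ρ = ρ' ∧ σ = σ' := by
  constructor <;> ext i
  · have := congrArg (fun τ : Perm (Fin (a + b)) => (τ (Fin.castAdd b i) : ℕ)) h
    simpa [skewSum_castAdd] using this
  · have := congrArg (fun τ : Perm (Fin (a + b)) => (τ (Fin.natAdd a i) : ℕ)) h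
    simpa [skewSum_natAdd] using this

/-- Counting suffices: each of the first `a` values has all `b` later values below it, and each of
the last `b` has `a` values above it. -/
theorem Split.exists_skewSum {π : Perm (Fin (a + b))} (h : Split a π) :
    ∃ (ρ : Perm (Fin a)) (σ : Perm (Fin b)), π = skewSum ρ σ := by
  have h1 : ∀ i : Fin a, b ≤ (π (Fin.castAdd b i) : ℕ) := by
    intro i
    have := Finset.card_le_card (s := (univ : Finset (Fin b)).map
      ((Fin.natAddEmb a).trans π.toEmbedding)) (t := Iio (π (Fin.castAdd b i))) ?_
    · simpa using this
    · intro x hx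
      simp only [mem_map, mem_univ, true_and] at hx
      obtain ⟨j, rfl⟩ := hx
      rw [mem_Iio]
      exact h _ _ (by simp) (by simp)
  have h2 : ∀ j : Fin b, (π (Fin.natAdd a j) : ℕ) < b := by
    intro j
    have := Finset.card_le_card (s := (univ : Finset (Fin a)).map
      ((Fin.castAddEmb b).trans π.toEmbedding)) (t := Ioi (π (Fin.natAdd a j))) ?_
    · simp at this
      have := (π (Fin.natAdd a j)).2
      omega
    · intro x hx
      simp only [mem_map, mem_univ, true_and] at hx
      obtain ⟨i, rfl⟩ := hx
      rw [mem_Ioi]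
      exact h _ _ (by simp) (by simp)
  let f : Fin a → Fin a := fun i => ⟨π (Fin.castAdd b i) - b, by
    have := (π (Fin.castAdd b i)).2
    have := i.2
    omega⟩
  let g : Fin b → Fin b := fun j => ⟨π (Fin.natAdd a j), h2 j⟩
  have hf : Function.Injective f := by
    intro i j hij
    have := h1 i
    have := h1 j
    have h3 : (π (Fin.castAdd b i) : ℕ) = π (Fin.castAdd b j) := by
      have := congrArg Fin.val hij
      simp only [f] at this
      omega
    simpa using π.injective (Fin.ext h3)
  have hg : Function.Injective g := by
    intro i j hij
    have h3 : (π (Fin.natAdd a i) : ℕ) = π (Fin.natAdd a j) := by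
      simpa [g] using hij
    simpa using π.injective (Fin.ext h3)
  refine ⟨Equiv.ofBijective f (Finite.injective_iff_bijective.1 hf),
    Equiv.ofBijective g (Finite.injective_iff_bijective.1 hg), ?_⟩
  ext i
  induction i using Fin.addCases with
  | left i =>
    rw [skewSum_castAdd]
    have := h1 i
    simp only [Equiv.ofBijective_apply, f]
    omega
  | right j =>
    rw [skewSum_natAdd]
    rfl

theorem castAdd_lt_castAdd (i j : Fin a) : Fin.castAdd b i < Fin.castAdd b j ↔ i < j :=
  Iff.rfl

theorem skewSum_lt_castAdd (i j : Fin a) :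
    skewSum ρ σ (Fin.castAdd b i) < skewSum ρ σ (Fin.castAdd b j) ↔ ρ i < ρ j := by
  rw [Fin.lt_def, Fin.lt_def, skewSum_castAdd, skewSum_castAdd]
  omega

theorem skewSum_lt_natAdd (i j : Fin b) :
    skewSum ρ σ (Fin.natAdd a i) < skewSum ρ σ (Fin.natAdd a j) ↔ σ i < σ j := by
  rw [Fin.lt_def, Fin.lt_def, skewSum_natAdd, skewSum_natAdd]

theorem skewSum_natAdd_lt_castAdd (i : Fin b) (j : Fin a) :
    skewSum ρ σ (Fin.natAdd a i) < skewSum ρ σ (Fin.castAdd b j) := by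
  rw [Fin.lt_def, skewSum_castAdd, skewSum_natAdd]
  omega

theorem castAdd_lt_natAdd (i : Fin a) (j : Fin b) : Fin.castAdd b i < Fin.natAdd a j := by
  rw [Fin.lt_def]
  simp
  omega

/-- The pattern `132` is not itself a skew sum, so no occurrence can meet both blocks. -/
theorem card_occ132_skewSum :
    (occ132 (skewSum ρ σ)).card = (occ132 ρ).card + (occ132 σ).card := by
  rw [← Finset.card_disjSum]
  symm
  refine Finset.card_bij (fun t _ => Sum.elim
    (fun t => (Fin.castAdd b t.1, Fin.castAdd b t.2.1, Fin.castAdd b t.2.2))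
    (fun t => (Fin.natAdd a t.1, Fin.natAdd a t.2.1, Fin.natAdd a t.2.2)) t) ?_ ?_ ?_
  · rintro (⟨x, y, z⟩ | ⟨x, y, z⟩) h
    · rw [inl_mem_disjSum, mem_occ132] at h
      simpa [mem_occ132, skewSum_lt_castAdd, castAdd_lt_castAdd] using h
    · rw [inr_mem_disjSum, mem_occ132] at h
      simpa [mem_occ132, skewSum_lt_natAdd] using h
  · rintro (⟨x, y, z⟩ | ⟨x, y, z⟩) _ (⟨x', y', z'⟩ | ⟨x', y', z'⟩) _ h
    · simpa using h
    · simp only [Sum.elim_inl, Sum.elim_inr, Prod.mk.injEq] at h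
      exact absurd h.1 (castAdd_lt_natAdd x x').ne
    · simp only [Sum.elim_inl, Sum.elim_inr, Prod.mk.injEq] at h
      exact absurd h.1 (castAdd_lt_natAdd x' x).ne'
    · simpa using h
  · rintro ⟨x, y, z⟩ h
    rw [mem_occ132] at h
    obtain ⟨h1, h2, h3, h4⟩ := id h
    induction x using Fin.addCases with
    | left x =>
      induction z using Fin.addCases with
      | left z =>
        induction y using Fin.addCases with
        | left y =>
          refine ⟨Sum.inl (x, y, z), ?_, rfl⟩
          rw [inl_mem_disjSum, mem_occ132]
          simpa [skewSum_lt_castAdd, castAdd_lt_castAdd] using h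
        | right y => exact absurd h2 (castAdd_lt_natAdd z y).not_gt
      | right z => exact absurd h3 (skewSum_natAdd_lt_castAdd ρ σ z x).not_gt
    | right x =>
      induction y using Fin.addCases with
      | left y => exact absurd h1 (castAdd_lt_natAdd y x).not_gt
      | right y =>
        induction z using Fin.addCases with
        | left z => exact absurd h2 (castAdd_lt_natAdd z y).not_gt
        | right z =>
          refine ⟨Sum.inr (x, y, z), ?_, rfl⟩
          rw [inr_mem_disjSum, mem_occ132]
          simpa [skewSum_lt_natAdd] using h

theorem card_inversions_skewSum :
    (inversions (skewSum ρ σ)).card = (inversions ρ).card + (inversions σ).card + a * b := by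
  have e : a * b = (univ : Finset (Fin a × Fin b)).card := by simp
  rw [e, ← Finset.card_disjSum, ← Finset.card_disjSum]
  symm
  refine Finset.card_bij (fun t _ => Sum.elim (Sum.elim
    (fun t => (Fin.castAdd b t.1, Fin.castAdd b t.2))
    (fun t => (Fin.natAdd a t.1, Fin.natAdd a t.2)))
    (fun t => (Fin.castAdd b t.1, Fin.natAdd a t.2)) t) ?_ ?_ ?_
  · rintro ((⟨x, y⟩ | ⟨x, y⟩) | ⟨x, y⟩) h
    · simpa [inversions, skewSum_lt_castAdd, castAdd_lt_castAdd] using h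
    · simpa [inversions, skewSum_lt_natAdd] using h
    · simp [inversions, skewSum_natAdd_lt_castAdd, castAdd_lt_natAdd]
  · have ne1 := fun (i : Fin a) (j : Fin b) => (castAdd_lt_natAdd i j).ne
    have ne2 := fun (i : Fin a) (j : Fin b) => (castAdd_lt_natAdd i j).ne'
    rintro ((⟨x, y⟩ | ⟨x, y⟩) | ⟨x, y⟩) _ ((⟨x', y'⟩ | ⟨x', y'⟩) | ⟨x', y'⟩) _ h <;>
      simp [ne1, ne2] at h ⊢ <;> exact h
  · rintro ⟨x, y⟩ h
    simp only [inversions, mem_filter, mem_univ, true_and] at h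
    obtain ⟨h1, h2⟩ := id h
    induction x using Fin.addCases with
    | left x =>
      induction y using Fin.addCases with
      | left y =>
        exact ⟨Sum.inl (Sum.inl (x, y)), by
          simpa [inversions, skewSum_lt_castAdd, castAdd_lt_castAdd] using h, rfl⟩
      | right y => exact ⟨Sum.inr (x, y), by simp, rfl⟩
    | right x =>
      induction y using Fin.addCases with
      | left y => exact absurd h1 (castAdd_lt_natAdd y x).not_gt
      | right y =>
        exact ⟨Sum.inl (Sum.inr (x, y)), by
          simpa [inversions, skewSum_lt_natAdd] using h, rfl⟩

theorem sign_skewSum :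
    Perm.sign (skewSum ρ σ) = Perm.sign ρ * Perm.sign σ * (-1) ^ (a * b) := by
  simp only [sign_eq_neg_one_pow_card_inversions, card_inversions_skewSum, pow_add]

theorem lisLt_skewSum (k : ℕ) :
    LISLt k (skewSum ρ σ) ↔ LISLt k ρ ∧ LISLt k σ := by
  constructor
  · intro h
    constructor
    · intro s hs
      have := h (s.map (Fin.castAddEmb b)) ?_
      · simpa using this
      · intro x hx y hy hxy
        simp only [coe_map, Set.mem_image, mem_coe] at hx hy
        obtain ⟨x, hx, rfl⟩ := hx
        obtain ⟨y, hy, rfl⟩ := hy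
        exact (skewSum_lt_castAdd ρ σ x y).2 (hs hx hy (by simpa [castAdd_lt_castAdd] using hxy))
    · intro s hs
      have := h (s.map (Fin.natAddEmb a)) ?_
      · simpa using this
      · intro x hx y hy hxy
        simp only [coe_map, Set.mem_image, mem_coe] at hx hy
        obtain ⟨x, hx, rfl⟩ := hx
        obtain ⟨y, hy, rfl⟩ := hy
        exact (skewSum_lt_natAdd ρ σ x y).2 (hs hx hy (by simpa [castAdd_lt_castAdd] using hxy))
  · rintro ⟨h1, h2⟩ s hs
    by_cases h : ∃ i : Fin a, Fin.castAdd b i ∈ s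
    · obtain ⟨i, hi⟩ := h
      have hsub : s ⊆ (s.preimage (Fin.castAdd b) (Fin.castAdd_injective a b).injOn).map
          (Fin.castAddEmb b) := by
        intro x hx
        induction x using Fin.addCases with
        | left x => simp [hx]
        | right x =>
          exact absurd (hs hi hx (castAdd_lt_natAdd i x))
            (skewSum_natAdd_lt_castAdd ρ σ x i).not_gt
      have := Finset.card_le_card hsub
      rw [card_map] at this
      refine this.trans_lt (h1 _ ?_)
      intro x hx y hy hxy
      simp only [coe_preimage, Set.mem_preimage, mem_coe] at hx hy
      exact (skewSum_lt_castAdd ρ σ x y).1 (hs hx hy (by simpa [castAdd_lt_castAdd] using hxy))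
    · push Not at h
      have hsub : s ⊆ (s.preimage (Fin.natAdd a) (Fin.natAdd_injective b a).injOn).map
          (Fin.natAddEmb a) := by
        intro x hx
        induction x using Fin.addCases with
        | left x => exact absurd hx (h x)
        | right x => simp [hx]
      have := Finset.card_le_card hsub
      rw [card_map] at this
      refine this.trans_lt (h2 _ ?_)
      intro x hx y hy hxy
      simp only [coe_preimage, Set.mem_preimage, mem_coe] at hx hy
      exact (skewSum_lt_natAdd ρ σ x y).1 (hs hx hy (by simpa [castAdd_lt_castAdd] using hxy))

theorem topAt_skewSum : TopAt a (skewSum ρ σ) ↔ TopAt a ρ := by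
  constructor
  · rintro ⟨i, hi, h⟩
    induction i using Fin.addCases with
    | left i =>
      rw [skewSum_castAdd] at h
      exact ⟨i, by simpa using hi, by omega⟩
    | right i => simp at hi; omega
  · rintro ⟨i, hi, h⟩
    refine ⟨Fin.castAdd b i, by simpa using hi, ?_⟩
    rw [skewSum_castAdd]
    omega

end

/-! ### Involutions that are skew sums -/

/-- The skew sum of `ρ`, `σ` and `ρ⁻¹`. -/
def sandwich {a l : ℕ} (ρ : Perm (Fin a)) (σ : Perm (Fin l)) : Perm (Fin (a + (l + a))) :=
  skewSum ρ (skewSum σ ρ⁻¹)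

section
variable {a l : ℕ} (ρ : Perm (Fin a)) (σ : Perm (Fin l))

theorem sandwich_left (i : Fin a) :
    sandwich ρ σ (Fin.castAdd _ i) = Fin.natAdd a (Fin.natAdd l (ρ i)) := by
  ext
  rw [sandwich, skewSum_castAdd]
  simp only [Fin.val_natAdd]
  omega

theorem sandwich_mid (i : Fin l) :
    sandwich ρ σ (Fin.natAdd a (Fin.castAdd a i)) = Fin.natAdd a (Fin.castAdd a (σ i)) := by
  ext
  rw [sandwich, skewSum_natAdd, skewSum_castAdd]
  simp

theorem sandwich_right (i : Fin a) :
    sandwich ρ σ (Fin.natAdd a (Fin.natAdd l i)) = Fin.castAdd _ (ρ⁻¹ i) := by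
  ext
  rw [sandwich, skewSum_natAdd, skewSum_natAdd]
  simp

theorem inv_sandwich : (sandwich ρ σ)⁻¹ = sandwich ρ σ⁻¹ := by
  rw [inv_eq_iff_mul_eq_one]
  ext i
  rw [Perm.mul_apply]
  induction i using Fin.addCases with
  | left i => rw [sandwich_left, sandwich_right]; simp
  | right i =>
    induction i using Fin.addCases with
    | left i => rw [sandwich_mid, sandwich_mid]; simp
    | right i => rw [sandwich_right, sandwich_left]; simp

theorem sandwich_injective {ρ ρ' : Perm (Fin a)} {σ σ' : Perm (Fin l)}
    (h : sandwich ρ σ = sandwich ρ' σ') : ρ = ρ' ∧ σ = σ' := by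
  obtain ⟨h1, h2⟩ := skewSum_injective h
  exact ⟨h1, (skewSum_injective h2).1⟩

/-- The factor 2 is decisive: a total of one forces `ρ` to avoid `132` and puts the occurrence in
`σ`. -/
theorem card_occ132_sandwich :
    (occ132 (sandwich ρ σ)).card = 2 * (occ132 ρ).card + (occ132 σ).card := by
  rw [sandwich, card_occ132_skewSum, card_occ132_skewSum, card_occ132_inv]
  ring

theorem lisLt_sandwich (k : ℕ) : LISLt k (sandwich ρ σ) ↔ LISLt k ρ ∧ LISLt k σ := by
  rw [sandwich, lisLt_skewSum, lisLt_skewSum, lisLt_inv]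
  tauto

/-- The signs of `ρ` and `ρ⁻¹` cancel. The inversions between blocks number `a * (l + a) + l * a`,
which has the parity of `a`. -/
theorem sign_sandwich : Perm.sign (sandwich ρ σ) = (-1) ^ a * Perm.sign σ := by
  rw [sandwich, sign_skewSum, sign_skewSum, Perm.sign_inv]
  have h1 : Perm.sign ρ * Perm.sign ρ = 1 := Int.units_mul_self _
  have h2 : ((-1 : ℤˣ)) ^ (l * a) * (-1) ^ (l * a) = 1 := Int.units_mul_self _
  have h3 : ((-1 : ℤˣ)) ^ (a * a) = (-1) ^ a := by
    rcases Nat.even_or_odd a with h | h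
    · rw [h.neg_one_pow, (h.mul_left a).neg_one_pow]
    · rw [h.neg_one_pow, (h.mul h).neg_one_pow]
  rw [mul_add, pow_add, h3, Nat.mul_comm a l]
  generalize ((-1 : ℤˣ)) ^ (l * a) = u at *
  generalize ((-1 : ℤˣ)) ^ a = v at *
  calc _ = (Perm.sign ρ * Perm.sign ρ) * (u * u) * (v * Perm.sign σ) := by
        ac_rfl
    _ = _ := by rw [h1, h2, one_mul, one_mul]

theorem exists_sandwich {π : Perm (Fin (a + (l + a)))} (hπ : π⁻¹ = π) (h : Split a π) :
    ∃ (ρ : Perm (Fin a)) (σ : Perm (Fin l)), σ⁻¹ = σ ∧ π = sandwich ρ σ := by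
  have inv (i) : π (π i) = i := by
    nth_rw 1 [← hπ]
    simp
  obtain ⟨ρ, τ, rfl⟩ := h.exists_skewSum
  -- The final `a` positions are the values of the first block, so there the involution must undo
  -- `ρ`.
  have h1 (i : Fin a) : (τ (Fin.natAdd l i) : ℕ) = ρ⁻¹ i := by
    have e : Fin.natAdd a (Fin.natAdd l i) = skewSum ρ τ (Fin.castAdd _ (ρ⁻¹ i)) := by
      ext
      rw [skewSum_castAdd]
      simp
      omega
    rw [← skewSum_natAdd ρ τ, e, inv]
    simp
  -- A middle position with a value below `a` would be the image of one of the first `a` positions,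
  -- whose values are all at least `l + a`.
  have h2 (i : Fin l) : a ≤ (τ (Fin.castAdd a i) : ℕ) := by
    by_contra! hlt
    have e : skewSum ρ τ (Fin.natAdd a (Fin.castAdd a i)) = Fin.castAdd (l + a) ⟨_, hlt⟩ := by
      ext
      rw [skewSum_natAdd]
      simp
    have e2 := inv (Fin.natAdd a (Fin.castAdd a i))
    rw [e] at e2
    have e3 := congrArg Fin.val e2
    rw [skewSum_castAdd] at e3
    simp at e3
    omega
  have h3 : Split l τ := by
    intro i j hi hj
    induction i using Fin.addCases with
    | right i => simp at hi
    | left i =>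
      induction j using Fin.addCases with
      | left j => simp at hj; omega
      | right j =>
        rw [Fin.lt_def, h1]
        exact (ρ⁻¹ j).2.trans_le (h2 i)
  obtain ⟨σ, ρ', rfl⟩ := h3.exists_skewSum
  have e : ρ' = ρ⁻¹ := by
    ext i
    rw [← h1, skewSum_natAdd]
  subst e
  refine ⟨ρ, σ, ?_, rfl⟩
  change (sandwich ρ σ)⁻¹ = sandwich ρ σ at hπ
  rw [inv_sandwich] at hπ
  exact (sandwich_injective hπ).2

end

/-! ### The position of the largest entry -/

theorem topAt_iff {n a : ℕ} {π : Perm (Fin (n + 1))} :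
    TopAt a π ↔ (π⁻¹ (Fin.last n) : ℕ) + 1 = a := by
  constructor
  · rintro ⟨i, hi, h⟩
    have : π i = Fin.last n := Fin.ext (by simpa using h)
    rw [← this]
    simpa using hi
  · intro h
    exact ⟨_, h, by simp⟩

/-- Any failure of the splitting at the maximum is witnessed by a `132` whose `3` is the maximum.
This is the only source of occurrences in this part. -/
theorem TopAt.mem_occ132 {n a : ℕ} {π : Perm (Fin n)} {y i j : Fin n} (hy : (y : ℕ) + 1 = a)
    (h : (π y : ℕ) + 1 = n) (hi : (i : ℕ) < a) (hj : a ≤ (j : ℕ)) (hij : ¬ π j < π i) :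
    (i, y, j) ∈ occ132 π := by
  rw [_root_.mem_occ132]
  have hne : π i ≠ π j := π.injective.ne (by rintro rfl; omega)
  have hne' : π j ≠ π y := π.injective.ne (by rintro rfl; omega)
  have h1 : π i < π j := lt_of_le_of_ne (not_lt.1 hij) hne
  have h2 : π j < π y := by
    have := (π j).2
    rw [Ne, Fin.ext_iff] at hne'
    rw [Fin.lt_def]
    omega
  have h3 : i ≠ y := by rintro rfl; exact absurd (h1.trans h2) (lt_irrefl _)
  refine ⟨?_, ?_, h1, h2⟩
  · rw [Ne, Fin.ext_iff] at h3
    rw [Fin.lt_def]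
    omega
  · rw [Fin.lt_def]
    omega

theorem TopAt.split {n a : ℕ} {π : Perm (Fin n)} (h : TopAt a π) (h0 : occ132 π = ∅) :
    Split a π := by
  intro i j hi hj
  by_contra hij
  obtain ⟨y, hy, hπ⟩ := h
  have := TopAt.mem_occ132 hy hπ hi hj hij
  simp [h0] at this

theorem TopAt.two_mul_le {n a : ℕ} {π : Perm (Fin n)} (hπ : π⁻¹ = π) (h : TopAt a π)
    (ha : a < n) (hs : Split a π) : 2 * a ≤ n := by
  obtain ⟨y, hy, hπy⟩ := h
  have e : π (π y) = y := by
    nth_rw 1 [← hπ]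
    simp
  -- The value at the last position `π y` is `y`. By the splitting, the first `a` entries all exceed
  -- it, and only `n - a` values do.
  have := Finset.card_le_card (s := (Iic y).map π.toEmbedding) (t := Ioi y) ?_
  · simp at this
    omega
  · intro x hx
    simp only [mem_map, mem_Iic, Equiv.coe_toEmbedding] at hx
    obtain ⟨i, hi, rfl⟩ := hx
    rw [mem_Ioi]
    rw [Fin.le_def] at hi
    have := hs i (π y) (by omega) (by omega)
    rwa [e] at this

/-- If the largest entry of an involution with one occurrence of `132` takes part in it, then the
occurrence consists of a fixed point at the position before the largest entry, the largest entry
and the last entry. -/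
theorem TopAt.not_split {n a : ℕ} {π : Perm (Fin n)} (hπ : π⁻¹ = π)
    (h1 : (occ132 π).card = 1) (h : TopAt a π) (hs : ¬ Split a π) :
    ∃ (m : ℕ) (x y z : Fin n), n = m + 1 + (1 + (m + 1)) ∧ a = m + 2 ∧ occ132 π = {(x, y, z)} ∧
      (x : ℕ) = m ∧ (y : ℕ) = m + 1 ∧ (z : ℕ) + 1 = n ∧ π x = x ∧ π y = z ∧ π z = y ∧
      ∀ i l : Fin n, (i : ℕ) < m → a ≤ (l : ℕ) → π l < π i := by
  obtain ⟨y, hy, hπy⟩ := h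
  have inv (i) : π (π i) = i := by
    nth_rw 1 [← hπ]
    simp
  obtain ⟨⟨x', y', z'⟩, ht⟩ := Finset.card_eq_one.1 h1
  have uniq {i j k : Fin n} (h : (i, j, k) ∈ occ132 π) : i = x' ∧ j = y' ∧ k = z' := by
    rw [ht, mem_singleton] at h
    simpa using h
  simp only [Split, not_forall] at hs
  obtain ⟨x, z, hx, hz, hxz⟩ := hs
  have hmem := TopAt.mem_occ132 hy hπy hx hz hxz
  obtain ⟨rfl, rfl, rfl⟩ := uniq hmem
  have hm := _root_.mem_occ132.1 hmem
  -- An involution sends the occurrence `(x, y, z)` to the occurrence `(π x, π z, π y)`, and by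
  -- uniqueness the two coincide.
  obtain ⟨ex, ez, ey⟩ := uniq (i := π x) (j := π z) (k := π y) (by
    rw [_root_.mem_occ132, inv, inv, inv]
    exact ⟨hm.2.2.1, hm.2.2.2, hm.1, hm.2.1⟩)
  have low (l : Fin n) (hl : y < l) (hlz : l ≠ z) : π l < x := by
    by_contra hlt
    rw [← ex] at hlt
    exact hlz (uniq (TopAt.mem_occ132 hy hπy hx (by rw [Fin.lt_def] at hl; omega) hlt)).2.2
  have high (i : Fin n) (hi : i < y) (hix : i ≠ x) : y < π i := by
    by_contra hlt
    rw [← ez] at hlt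
    exact hix (uniq (TopAt.mem_occ132 hy hπy (by rw [Fin.lt_def] at hi; omega) hz hlt)).1
  -- A position `u` strictly between `x` and `y` would give a second occurrence `(x, u, z)`.
  have hxy : (x : ℕ) + 1 = y := by
    by_contra hne
    have hlt : (x : ℕ) < y := hm.1
    let u : Fin n := ⟨x + 1, by omega⟩
    have hxu : x < u := by rw [Fin.lt_def]; simp [u]
    have huy : u < y := by rw [Fin.lt_def]; simp only [u]; omega
    have := uniq (i := x) (j := u) (k := z) (_root_.mem_occ132.2
      ⟨hxu, huy.trans hm.2.1, hm.2.2.1, by rw [ez]; exact high u huy hxu.ne'⟩)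
    exact huy.ne this.2.1
  -- The involution maps the positions between `y` and `z` below `x` and conversely; comparing sizes
  -- determines `n`.
  have c1 := Finset.card_le_card (s := (Ioo y z).map π.toEmbedding) (t := Iio x) (by
    intro l hl
    simp only [mem_map, mem_Ioo, Equiv.coe_toEmbedding] at hl
    obtain ⟨l, hl, rfl⟩ := hl
    exact mem_Iio.2 (low l hl.1 hl.2.ne))
  have c2 := Finset.card_le_card (s := (Iio x).map π.toEmbedding) (t := Ioo y z) (by
    intro i hi
    simp only [mem_map, mem_Iio, Equiv.coe_toEmbedding] at hi
    obtain ⟨i, hi, rfl⟩ := hi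
    refine mem_Ioo.2 ⟨high i (hi.trans hm.1) hi.ne, lt_of_le_of_ne ?_ ?_⟩
    · rw [Fin.le_def]
      have := (π i).2
      rw [ey] at hπy
      omega
    · intro h
      have : i = y := π.injective (h.trans ey.symm)
      rw [this] at hi
      exact hi.not_gt hm.1)
  rw [card_map, Fin.card_Iio, Fin.card_Ioo] at c1 c2
  have hyz : (y : ℕ) < z := hm.2.1
  rw [ey] at hπy
  refine ⟨x, x, y, z, by omega, by omega, ht, rfl, by omega, hπy, ex, ey, ez, fun i l hi hl => ?_⟩
  by_contra hlt
  have := (uniq (TopAt.mem_occ132 hy (by rwa [ey]) (by omega) hl hlt)).1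
  rw [this] at hi
  exact lt_irrefl _ hi

/-! ### Involutions whose largest entry takes part in the occurrence of `132` -/

section
variable {m : ℕ}

/-- The position `m`. -/
def pivot (m : ℕ) : Fin (m + 1 + (1 + (m + 1))) := ⟨m, by omega⟩

/-- The position `m + 1`. -/
def peak (m : ℕ) : Fin (m + 1 + (1 + (m + 1))) := ⟨m + 1, by omega⟩

/-- The last position. -/
def final (m : ℕ) : Fin (m + 1 + (1 + (m + 1))) := ⟨2 * m + 2, by omega⟩

/-- Exchange of the positions `m` and `m + 1`. -/
def pivotSwap (m : ℕ) : Perm (Fin (m + 1 + (1 + (m + 1)))) := swap (pivot m) (peak m)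

theorem pivotSwap_pivot : pivotSwap m (pivot m) = peak m := swap_apply_left _ _

theorem pivotSwap_peak : pivotSwap m (peak m) = pivot m := swap_apply_right _ _

theorem pivotSwap_of_ne {i : Fin (m + 1 + (1 + (m + 1)))} (h1 : (i : ℕ) ≠ m)
    (h2 : (i : ℕ) ≠ m + 1) : pivotSwap m i = i :=
  swap_apply_of_ne_of_ne (fun h => h1 (congrArg Fin.val h)) (fun h => h2 (congrArg Fin.val h))

theorem pivotSwap_pivotSwap (i : Fin (m + 1 + (1 + (m + 1)))) :
    pivotSwap m (pivotSwap m i) = i := by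
  rw [← Perm.mul_apply, pivotSwap, swap_mul_self, Perm.one_apply]

theorem pivotSwap_mul_self : pivotSwap m * pivotSwap m = 1 := swap_mul_self _ _

theorem val_pivotSwap {i : Fin (m + 1 + (1 + (m + 1)))} (h : i ≠ pivot m) :
    (pivotSwap m i : ℕ) = if (i : ℕ) = m + 1 then m else i := by
  have h1 : (i : ℕ) ≠ m := fun e => h (Fin.ext e)
  split_ifs with h2
  · have : i = peak m := Fin.ext h2
    rw [this, pivotSwap_peak]
    rfl
  · rw [pivotSwap_of_ne h1 h2]

/-- An adjacent transposition reverses only the order of the pair it exchanges, and that pair is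
broken once `m` is excluded. -/
theorem pivotSwap_lt_iff {i j : Fin (m + 1 + (1 + (m + 1)))} (hi : i ≠ pivot m)
    (hj : j ≠ pivot m) : pivotSwap m i < pivotSwap m j ↔ i < j := by
  have hi' : (i : ℕ) ≠ m := fun e => hi (Fin.ext e)
  have hj' : (j : ℕ) ≠ m := fun e => hj (Fin.ext e)
  rw [Fin.lt_def, Fin.lt_def, val_pivotSwap hi, val_pivotSwap hj]
  split_ifs <;> omega

/-- The skew sum of `ρ`, one point and `ρ⁻¹` with the positions and the values `m` and `m + 1`
exchanged. -/
def pivotGlue (ρ : Perm (Fin (m + 1))) : Perm (Fin (m + 1 + (1 + (m + 1)))) :=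
  pivotSwap m * sandwich ρ 1 * pivotSwap m

theorem pivotGlue_apply (ρ : Perm (Fin (m + 1))) (i : Fin (m + 1 + (1 + (m + 1)))) :
    pivotGlue ρ i = pivotSwap m (sandwich ρ 1 (pivotSwap m i)) := rfl

theorem inv_pivotGlue (ρ : Perm (Fin (m + 1))) : (pivotGlue ρ)⁻¹ = pivotGlue ρ := by
  have : (pivotSwap m)⁻¹ = pivotSwap m := swap_inv _ _
  rw [pivotGlue, mul_inv_rev, mul_inv_rev, this, inv_sandwich, inv_one, mul_assoc]

theorem sign_pivotGlue (ρ : Perm (Fin (m + 1))) :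
    Perm.sign (pivotGlue ρ) = (-1) ^ (m + 1) := by
  have h : Perm.sign (pivotSwap m) * Perm.sign (pivotSwap m) = 1 := Int.units_mul_self _
  rw [pivotGlue, map_mul, map_mul, sign_sandwich, mul_right_comm, h]
  simp

theorem pivotGlue_injective : Function.Injective (pivotGlue (m := m)) := by
  intro ρ ρ' h
  exact (sandwich_injective (mul_left_cancel (mul_right_cancel h))).1

variable {ρ : Perm (Fin (m + 1))}

theorem sandwich_peak : sandwich ρ (1 : Perm (Fin 1)) (peak m) = peak m := by
  have : peak m = Fin.natAdd (m + 1) (Fin.castAdd (m + 1) (0 : Fin 1)) := Fin.ext (by simp [peak])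
  rw [this, sandwich_mid]
  rfl

theorem pivotGlue_pivot : pivotGlue ρ (pivot m) = pivot m := by
  rw [pivotGlue_apply, pivotSwap_pivot, sandwich_peak, pivotSwap_peak]

theorem pivotGlue_ne_pivot {i : Fin (m + 1 + (1 + (m + 1)))} (h : i ≠ pivot m) :
    pivotGlue ρ i ≠ pivot m := by
  rw [← pivotGlue_pivot (ρ := ρ)]
  exact (pivotGlue ρ).injective.ne h

/-- Away from the pivot, `pivotGlue ρ` has the pattern of the sandwich without its middle point.
Only subsequences through the pivot need separate study. -/
theorem pivotGlue_lt_iff {i j : Fin (m + 1 + (1 + (m + 1)))} (hi : i ≠ pivot m)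
    (hj : j ≠ pivot m) : pivotGlue ρ i < pivotGlue ρ j ↔
      sandwich ρ (1 : Perm (Fin 1)) (pivotSwap m i) < sandwich ρ 1 (pivotSwap m j) := by
  rw [← pivotSwap_lt_iff (pivotGlue_ne_pivot hi) (pivotGlue_ne_pivot hj), pivotGlue_apply,
    pivotGlue_apply, pivotSwap_pivotSwap, pivotSwap_pivotSwap]

theorem lt_pivotGlue {i : Fin (m + 1 + (1 + (m + 1)))} (h : (i : ℕ) < m) :
    m + 1 < (pivotGlue ρ i : ℕ) := by
  have e : i = Fin.castAdd _ (⟨i, by omega⟩ : Fin (m + 1)) := rfl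
  rw [pivotGlue_apply, pivotSwap_of_ne (i := i) (by omega) (by omega), e, sandwich_left,
    pivotSwap_of_ne] <;> simp <;> omega

theorem pivotGlue_peak (hρ : TopAt (m + 1) ρ) : pivotGlue ρ (peak m) = final m := by
  obtain ⟨ρ, rfl⟩ := hρ.exists_extTop
  have e : pivot m = Fin.castAdd _ (Fin.last m) := rfl
  rw [pivotGlue_apply, pivotSwap_peak, e, sandwich_left, extTop_last, pivotSwap_of_ne]
  · ext
    simp [final]
    omega
  · simp
    omega
  · simp

theorem pivotGlue_final (hρ : TopAt (m + 1) ρ) : pivotGlue ρ (final m) = peak m := by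
  rw [← pivotGlue_peak hρ]
  nth_rw 1 [← inv_pivotGlue]
  simp

theorem pivotGlue_lt (hρ : TopAt (m + 1) ρ) {i : Fin (m + 1 + (1 + (m + 1)))}
    (h : m + 2 ≤ (i : ℕ)) (h' : i ≠ final m) : (pivotGlue ρ i : ℕ) < m := by
  obtain ⟨ρ, rfl⟩ := hρ.exists_extTop
  have h1 : (i : ℕ) ≠ 2 * m + 2 := fun e => h' (Fin.ext e)
  have e : i = Fin.natAdd (m + 1) (Fin.natAdd 1 (Fin.castSucc ⟨i - (m + 2), by omega⟩)) := by
    ext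
    simp
    omega
  rw [pivotGlue_apply, pivotSwap_of_ne (i := i) (by omega) (by omega), e, sandwich_right, inv_extTop,
    extTop_castSucc, pivotSwap_of_ne]
  · simp
  · simp
    omega
  · simp
    omega

theorem topAt_pivotGlue (hρ : TopAt (m + 1) ρ) : TopAt (m + 2) (pivotGlue ρ) :=
  ⟨peak m, rfl, by rw [pivotGlue_peak hρ]; simp [final]; omega⟩

theorem not_split_pivotGlue (hρ : TopAt (m + 1) ρ) : ¬ Split (m + 2) (pivotGlue ρ) := by
  intro h
  have := h (pivot m) (final m) (by simp [pivot]) (by simp [final]; omega)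
  rw [pivotGlue_pivot, pivotGlue_final hρ, Fin.lt_def] at this
  simp [pivot, peak] at this

theorem pivot_mem_occ132 (hρ : TopAt (m + 1) ρ) :
    (pivot m, peak m, final m) ∈ occ132 (pivotGlue ρ) := by
  rw [mem_occ132, pivotGlue_pivot, pivotGlue_final hρ, pivotGlue_peak hρ]
  simp only [pivot, peak, final, Fin.lt_def]
  omega

theorem card_occ132_pivotGlue (hρ : TopAt (m + 1) ρ) :
    (occ132 (pivotGlue ρ)).card = 1 ↔ occ132 ρ = ∅ := by
  constructor
  · intro h
    rw [Finset.eq_empty_iff_forall_notMem]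
    rintro ⟨x, y, z⟩ hmem
    obtain ⟨t, ht⟩ := Finset.card_eq_one.1 h
    have h1 := pivot_mem_occ132 hρ
    have ne (i : Fin (m + 1)) : pivotSwap m (Fin.castAdd (1 + (m + 1)) i) ≠ pivot m := by
      rw [← pivotSwap_peak]
      refine (pivotSwap m).injective.ne fun e => ?_
      have := congrArg Fin.val e
      simp [peak] at this
      omega
    have h2 : (pivotSwap m (Fin.castAdd _ x), pivotSwap m (Fin.castAdd _ y),
        pivotSwap m (Fin.castAdd _ z)) ∈ occ132 (pivotGlue ρ) := by
      rw [mem_occ132] at hmem ⊢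
      rw [pivotGlue_lt_iff (ne _) (ne _), pivotGlue_lt_iff (ne _) (ne _),
        ← pivotSwap_lt_iff (ne _) (ne _), ← pivotSwap_lt_iff (ne _) (ne _)]
      simp only [pivotSwap_pivotSwap]
      rw [sandwich, skewSum_lt_castAdd, skewSum_lt_castAdd]
      exact hmem
    rw [ht, mem_singleton] at h1 h2
    rw [← h1] at h2
    exact ne x (congrArg Prod.fst h2)
  · intro h
    refine Finset.card_eq_one.2 ⟨_, Finset.eq_singleton_iff_unique_mem.2
      ⟨pivot_mem_occ132 hρ, ?_⟩⟩
    have hs : occ132 (sandwich ρ (1 : Perm (Fin 1))) = ∅ := by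
      rw [← Finset.card_eq_zero, card_occ132_sandwich, h,
        show occ132 (1 : Perm (Fin 1)) = ∅ by decide]
      rfl
    rintro ⟨x, y, z⟩ hmem
    rw [mem_occ132] at hmem
    obtain ⟨h1, h2, h3, h4⟩ := hmem
    have h13 := h1.trans h2
    have hxy := h3.trans h4
    by_cases hx : x = pivot m
    · subst hx
      rw [pivotGlue_pivot] at h3 hxy
      have hz : z = final m := by
        by_contra hz
        have : ¬ m + 2 ≤ (z : ℕ) := fun h => by
          have := pivotGlue_lt hρ h hz
          rw [Fin.lt_def] at h3
          simp only [pivot] at h3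
          omega
        rw [Fin.lt_def] at h1 h2
        simp only [pivot] at h1
        omega
      subst hz
      have hy : y = peak m := by
        by_contra hy
        have hy' : (y : ℕ) ≠ m + 1 := fun e => hy (Fin.ext e)
        rw [Fin.lt_def] at h1
        have := pivotGlue_lt hρ (i := y) (by simp only [pivot] at h1; omega) h2.ne
        rw [Fin.lt_def] at hxy
        simp only [pivot] at hxy
        omega
      rw [hy]
    · exfalso
      by_cases hy : y = pivot m
      · subst hy
        have := lt_pivotGlue (ρ := ρ) (i := x) h1
        rw [pivotGlue_pivot, Fin.lt_def] at hxy
        simp only [pivot] at hxy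
        omega
      · by_cases hz : z = pivot m
        · subst hz
          have := lt_pivotGlue (ρ := ρ) (i := x) h13
          rw [pivotGlue_pivot, Fin.lt_def] at h3
          simp only [pivot] at h3
          omega
        · rw [pivotGlue_lt_iff hx hz] at h3
          rw [pivotGlue_lt_iff hz hy] at h4
          rw [← pivotSwap_lt_iff hx hy] at h1
          rw [← pivotSwap_lt_iff hy hz] at h2
          have := mem_occ132.2 ⟨h1, h2, h3, h4⟩
          simp [hs] at this

/-- Every increasing subsequence through the pivot has at most two terms, the other being the peak
or the last position; hence the bound on `k`. -/
theorem lisLt_pivotGlue (hρ : TopAt (m + 1) ρ) {k : ℕ} (hk : 3 ≤ k) :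
    LISLt k (pivotGlue ρ) ↔ LISLt k ρ := by
  constructor
  · intro h s hs
    have ne (i : Fin (m + 1)) : pivotSwap m (Fin.castAdd (1 + (m + 1)) i) ≠ pivot m := by
      rw [← pivotSwap_peak]
      refine (pivotSwap m).injective.ne fun e => ?_
      have := congrArg Fin.val e
      simp [peak] at this
      omega
    have := h (s.map ((Fin.castAddEmb _).trans (pivotSwap m).toEmbedding)) ?_
    · simpa using this
    · intro x hx y hy hxy
      simp only [coe_map, Set.mem_image, mem_coe] at hx hy
      obtain ⟨x, hx, rfl⟩ := hx
      obtain ⟨y, hy, rfl⟩ := hy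
      change pivotSwap m (Fin.castAdd _ x) < pivotSwap m (Fin.castAdd _ y) at hxy
      change pivotGlue ρ (pivotSwap m (Fin.castAdd _ x)) <
        pivotGlue ρ (pivotSwap m (Fin.castAdd _ y))
      rw [pivotGlue_lt_iff (ne _) (ne _)]
      rw [← pivotSwap_lt_iff (ne _) (ne _)] at hxy
      simp only [pivotSwap_pivotSwap] at hxy ⊢
      rw [sandwich, skewSum_lt_castAdd]
      exact hs hx hy hxy
  · intro h s hs
    by_cases hp : pivot m ∈ s
    · have hsub : ∀ i ∈ s, i = pivot m ∨ i = peak m ∨ i = final m := by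
        intro i hi
        rcases lt_trichotomy i (pivot m) with hlt | heq | hgt
        · have h1 := hs hi hp hlt
          have := lt_pivotGlue (ρ := ρ) (i := i) hlt
          rw [pivotGlue_pivot, Fin.lt_def] at h1
          simp only [pivot] at h1
          omega
        · exact Or.inl heq
        · have h1 := hs hp hi hgt
          rw [pivotGlue_pivot, Fin.lt_def] at h1
          rw [Fin.lt_def] at hgt
          simp only [pivot] at h1 hgt
          refine Or.inr ?_
          by_contra! hne
          have hne' : (i : ℕ) ≠ m + 1 := fun e => hne.1 (Fin.ext e)
          have := pivotGlue_lt hρ (i := i) (by omega) hne.2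
          omega
      have hnot : ¬ (peak m ∈ s ∧ final m ∈ s) := by
        rintro ⟨h1, h2⟩
        have := hs h1 h2 (by simp [peak, final, Fin.lt_def]; omega)
        rw [pivotGlue_peak hρ, pivotGlue_final hρ, Fin.lt_def] at this
        simp only [peak, final] at this
        omega
      have : s ⊆ {pivot m, peak m} ∨ s ⊆ {pivot m, final m} := by
        by_cases h1 : peak m ∈ s
        · left
          intro i hi
          rcases hsub i hi with rfl | rfl | rfl
          · simp
          · simp
          · exact absurd ⟨h1, hi⟩ hnot
        · right
          intro i hi
          rcases hsub i hi with rfl | rfl | rfl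
          · simp
          · exact absurd hi h1
          · simp
      rcases this with h | h <;>
        exact lt_of_le_of_lt ((Finset.card_le_card h).trans Finset.card_le_two) hk
    · have := ((lisLt_sandwich ρ (1 : Perm (Fin 1)) k).2 ⟨h, fun u _ => by
        have := Finset.card_le_univ u
        simp at this
        omega⟩) (s.map (pivotSwap m).toEmbedding) ?_
      · simpa using this
      · intro x hx y hy hxy
        simp only [coe_map, Set.mem_image, mem_coe] at hx hy
        obtain ⟨x, hx, rfl⟩ := hx
        obtain ⟨y, hy, rfl⟩ := hy
        have hx' : x ≠ pivot m := by rintro rfl; exact hp hx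
        have hy' : y ≠ pivot m := by rintro rfl; exact hp hy
        exact (pivotGlue_lt_iff hx' hy').1 (hs hx hy ((pivotSwap_lt_iff hx' hy').1 hxy))

theorem exists_pivotGlue {π : Perm (Fin (m + 1 + (1 + (m + 1))))} (hπ : π⁻¹ = π)
    (h1 : (occ132 π).card = 1) (h : TopAt (m + 2) π) (hs : ¬ Split (m + 2) π) :
    ∃ ρ : Perm (Fin (m + 1)), TopAt (m + 1) ρ ∧ π = pivotGlue ρ := by
  obtain ⟨m', x, y, z, hm, -, -, hx, hy, hz, ex, ey, ez, hlt⟩ := h.not_split hπ h1 hs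
  obtain rfl : m' = m := by omega
  obtain rfl : x = pivot m' := Fin.ext hx
  obtain rfl : y = peak m' := Fin.ext hy
  obtain rfl : z = final m' := Fin.ext (by simp only [final]; omega)
  set τ := pivotSwap m' * π * pivotSwap m' with hτ
  have hπτ : π = pivotSwap m' * τ * pivotSwap m' := by
    rw [hτ, mul_assoc, mul_assoc, mul_assoc, pivotSwap_mul_self, mul_one, ← mul_assoc,
      pivotSwap_mul_self, one_mul]
  have hinv : τ⁻¹ = τ := by
    have : (pivotSwap m')⁻¹ = pivotSwap m' := swap_inv _ _
    rw [hτ, mul_inv_rev, mul_inv_rev, this, hπ, mul_assoc]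
  have ne {i} (h : i ≠ pivot m') : π i ≠ pivot m' := by
    rw [← ex]
    exact π.injective.ne h
  -- Undoing the exchange moves the maximum to position `m'` and the fixed point to the centre,
  -- which removes the only obstruction to splitting.
  have hsplit : Split (m' + 1) τ := by
    intro i j hi hj
    change pivotSwap m' (π (pivotSwap m' j)) < pivotSwap m' (π (pivotSwap m' i))
    by_cases hj' : j = peak m'
    · subst hj'
      rw [pivotSwap_peak, ex, pivotSwap_pivot]
      by_cases hi' : i = pivot m'
      · subst hi'
        rw [pivotSwap_pivot, ey, pivotSwap_of_ne] <;> simp [final, peak, Fin.lt_def] <;> omega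
      · have : (i : ℕ) ≠ m' := fun e => hi' (Fin.ext e)
        have h2 := hlt i (final m') (by omega) (by simp [final]; omega)
        rw [ez, Fin.lt_def] at h2
        simp only [peak] at h2
        rw [pivotSwap_of_ne (i := i) (by omega) (by omega), pivotSwap_of_ne (by omega) (by omega)]
        exact h2
    · have hj2 : (j : ℕ) ≠ m' + 1 := fun e => hj' (Fin.ext e)
      have hj3 : j ≠ pivot m' := by rintro rfl; simp [pivot] at hj
      rw [pivotSwap_of_ne (i := j) (by omega) (by omega)]
      by_cases hi' : i = pivot m'
      · subst hi'
        rw [pivotSwap_pivot, pivotSwap_lt_iff (ne hj3) (ne (by simp [peak, pivot])), ey]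
        refine lt_of_le_of_ne ?_ ?_
        · rw [Fin.le_def]
          simp only [final]
          omega
        · rw [← ey]
          exact π.injective.ne hj'
      · have : (i : ℕ) ≠ m' := fun e => hi' (Fin.ext e)
        rw [pivotSwap_of_ne (i := i) (by omega) (by omega), pivotSwap_lt_iff (ne hj3) (ne hi')]
        exact hlt i j (by omega) (by omega)
  obtain ⟨ρ, σ, -, e⟩ := exists_sandwich hinv hsplit
  -- The middle block has a single letter.
  obtain rfl : σ = 1 := Subsingleton.elim _ _
  refine ⟨ρ, ⟨Fin.last m', by simp, ?_⟩, by rw [hπτ, e]; rfl⟩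
  have e1 : τ (pivot m') = final m' := by
    change pivotSwap m' (π (pivotSwap m' (pivot m'))) = _
    rw [pivotSwap_pivot, ey, pivotSwap_of_ne] <;> simp [final] <;> omega
  have e2 : pivot m' = Fin.castAdd _ (Fin.last m') := rfl
  rw [e, e2, sandwich_left] at e1
  have := congrArg Fin.val e1
  simp [final] at this
  omega

end

/-! ### Counting -/

open Classical in
/-- The permutations of `n` letters that avoid `132` and have no increasing subsequence of
length `k`. -/
noncomputable def avoiders (n k : ℕ) : Finset (Perm (Fin n)) :=
  {π | occ132 π = ∅ ∧ LISLt k π}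

open Classical in
/-- The members of `avoiders n k` whose last entry is the largest. -/
noncomputable def avoidersTop (n k : ℕ) : Finset (Perm (Fin n)) :=
  {π | (occ132 π = ∅ ∧ LISLt k π) ∧ TopAt n π}

open Classical in
/-- The involutions of `n` letters that contain `132` once and have no increasing subsequence of
length `k`. -/
noncomputable def onceInvolutions (n k : ℕ) : Finset (Perm (Fin n)) :=
  {π | π⁻¹ = π ∧ (occ132 π).card = 1 ∧ LISLt k π}

theorem mem_avoiders {n k : ℕ} {π : Perm (Fin n)} :
    π ∈ avoiders n k ↔ occ132 π = ∅ ∧ LISLt k π := by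
  simp [avoiders]

theorem mem_avoidersTop {n k : ℕ} {π : Perm (Fin n)} :
    π ∈ avoidersTop n k ↔ (occ132 π = ∅ ∧ LISLt k π) ∧ TopAt n π := by
  simp [avoidersTop]

theorem mem_onceInvolutions {n k : ℕ} {π : Perm (Fin n)} :
    π ∈ onceInvolutions n k ↔ π⁻¹ = π ∧ (occ132 π).card = 1 ∧ LISLt k π := by
  simp [onceInvolutions]

open Classical in
theorem sum_eq_sum_topAt {n : ℕ} {M : Type*} [AddCommMonoid M] (S : Finset (Perm (Fin (n + 1))))
    (w : Perm (Fin (n + 1)) → M) :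
    ∑ π ∈ S, w π = ∑ a ∈ range (n + 2), ∑ π ∈ S with TopAt a π, w π := by
  rw [← Finset.sum_fiberwise_of_maps_to (t := range (n + 2))
    (g := fun π : Perm (Fin (n + 1)) => (π⁻¹ (Fin.last n) : ℕ) + 1)]
  · refine Finset.sum_congr rfl fun a _ => Finset.sum_congr ?_ fun _ _ => rfl
    ext π
    simp only [mem_filter, topAt_iff]
  · intro π _
    have := (π⁻¹ (Fin.last n)).2
    rw [mem_range]
    omega

theorem avoidersTop_zero (k : ℕ) : avoidersTop 0 k = ∅ := by
  rw [Finset.eq_empty_iff_forall_notMem]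
  intro π h
  obtain ⟨i, -⟩ := (mem_avoidersTop.1 h).2
  exact i.elim0

theorem card_avoidersTop_succ (n k : ℕ) :
    (avoidersTop (n + 1) (k + 1)).card = (avoiders n k).card := by
  symm
  refine Finset.card_bij (fun π _ => extTop π) ?_ (fun _ _ _ _ h => extTop_injective h) ?_
  · intro π h
    rw [mem_avoiders] at h
    rw [mem_avoidersTop, lisLt_extTop, ← Finset.card_eq_zero, card_occ132_extTop,
      Finset.card_eq_zero]
    exact ⟨h, topAt_extTop π⟩
  · intro π h
    rw [mem_avoidersTop] at h
    obtain ⟨ρ, rfl⟩ := h.2.exists_extTop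
    rw [lisLt_extTop, ← Finset.card_eq_zero, card_occ132_extTop, Finset.card_eq_zero] at h
    exact ⟨ρ, mem_avoiders.2 h.1, rfl⟩

open Classical in
theorem card_avoiders_topAt (a b k : ℕ) :
    (#{π ∈ avoiders (a + b) k | TopAt a π}) = (avoidersTop a k).card * (avoiders b k).card := by
  rw [← Finset.card_product]
  symm
  have h0 (ρ : Perm (Fin a)) (σ : Perm (Fin b)) :
      occ132 (skewSum ρ σ) = ∅ ↔ occ132 ρ = ∅ ∧ occ132 σ = ∅ := by
    rw [← Finset.card_eq_zero, card_occ132_skewSum, Nat.add_eq_zero_iff, Finset.card_eq_zero,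
      Finset.card_eq_zero]
  refine Finset.card_bij (fun p _ => skewSum p.1 p.2) ?_ ?_ ?_
  · rintro ⟨ρ, σ⟩ h
    rw [mem_product, mem_avoidersTop, mem_avoiders] at h
    rw [mem_filter, mem_avoiders, h0, lisLt_skewSum, topAt_skewSum]
    tauto
  · rintro ⟨ρ, σ⟩ _ ⟨ρ', σ'⟩ _ h
    exact Prod.ext_iff.2 (skewSum_injective h)
  · intro π h
    rw [mem_filter, mem_avoiders] at h
    obtain ⟨ρ, σ, rfl⟩ := (h.2.split h.1.1).exists_skewSum
    rw [h0, lisLt_skewSum, topAt_skewSum] at h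
    refine ⟨(ρ, σ), ?_, rfl⟩
    rw [mem_product, mem_avoidersTop, mem_avoiders]
    tauto

/-- Cut after the maximum. Deleting the maximum from the first block lowers the bound on increasing
subsequences there by one, but not in the second block. -/
theorem card_avoiders_succ (n k : ℕ) :
    (avoiders (n + 1) (k + 1)).card =
      ∑ p ∈ antidiagonal n, (avoiders p.1 k).card * (avoiders p.2 (k + 1)).card := by
  classical
  rw [Finset.card_eq_sum_ones, sum_eq_sum_topAt, Finset.sum_range_succ',
    Finset.Nat.sum_antidiagonal_eq_sum_range_succ_mk]
  have : ∑ π ∈ avoiders (n + 1) (k + 1) with TopAt 0 π, 1 = 0 := by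
    rw [Finset.filter_false_of_mem, Finset.sum_empty]
    rintro π - ⟨i, hi, -⟩
    omega
  rw [this, add_zero]
  refine Finset.sum_congr rfl fun a ha => ?_
  obtain ⟨b, rfl⟩ := Nat.exists_eq_add_of_le (Nat.lt_succ_iff.1 (mem_range.1 ha))
  rw [← Finset.card_eq_sum_ones, ← card_avoidersTop_succ, Nat.add_sub_cancel_left,
    ← card_avoiders_topAt, Nat.add_right_comm]

theorem card_avoiders_zero (k : ℕ) : (avoiders 0 (k + 1)).card = 1 := by
  rw [Finset.card_eq_one]
  refine ⟨1, Finset.eq_singleton_iff_unique_mem.2 ⟨mem_avoiders.2 ⟨by decide, fun s _ => ?_⟩,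
    fun _ _ => Subsingleton.elim _ _⟩⟩
  have := Finset.card_le_univ s
  simp at this
  simp [this]

theorem avoiders_lis_zero (n : ℕ) : avoiders n 0 = ∅ := by
  rw [Finset.eq_empty_iff_forall_notMem]
  intro π h
  exact absurd ((mem_avoiders.1 h).2 ∅ (by simp [StrictMonoOn])) (by simp)

/-- An occurrence of `132` already contains an increasing pair. -/
theorem onceInvolutions_two (n : ℕ) : onceInvolutions n 2 = ∅ := by
  rw [Finset.eq_empty_iff_forall_notMem]
  intro π h
  obtain ⟨-, h1, h2⟩ := mem_onceInvolutions.1 h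
  obtain ⟨⟨x, y, z⟩, ht⟩ := Finset.card_eq_one.1 h1
  have hm : (x, y, z) ∈ occ132 π := by rw [ht]; simp
  obtain ⟨hxy, -, h3, h4⟩ := mem_occ132.1 hm
  have := h2 {x, y} (by
    intro u hu v hv huv
    simp only [coe_insert, coe_singleton, Set.mem_insert_iff, Set.mem_singleton_iff] at hu hv
    rcases hu with rfl | rfl <;> rcases hv with rfl | rfl
    · exact absurd huv (lt_irrefl _)
    · exact h3.trans h4
    · exact absurd huv hxy.not_gt
    · exact absurd huv (lt_irrefl _))
  rw [Finset.card_pair hxy.ne] at this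
  exact lt_irrefl _ this

/-! ### Involutions weighted by a character of the sign. -/

section
variable (χ : ℤˣ →* ℂ)

/-- The number of members of `onceInvolutions n k`, weighted by a character of their sign. -/
noncomputable def onceWeight (n k : ℕ) : ℂ :=
  ∑ π ∈ onceInvolutions n k, χ (Perm.sign π)

open Classical in
theorem sum_once_topAt_last (n k : ℕ) :
    ∑ π ∈ onceInvolutions (n + 1) (k + 1) with TopAt (n + 1) π, χ (Perm.sign π) =
      onceWeight χ n k := by
  symm
  refine Finset.sum_bij (fun π _ => extTop π) ?_ (fun _ _ _ _ h => extTop_injective h) ?_ ?_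
  · intro π h
    rw [mem_onceInvolutions] at h
    rw [mem_filter, mem_onceInvolutions, lisLt_extTop, card_occ132_extTop, inv_extTop, h.1]
    exact ⟨⟨rfl, h.2⟩, topAt_extTop π⟩
  · intro π h
    rw [mem_filter, mem_onceInvolutions] at h
    obtain ⟨ρ, rfl⟩ := h.2.exists_extTop
    rw [lisLt_extTop, card_occ132_extTop, inv_extTop] at h
    exact ⟨ρ, mem_onceInvolutions.2 ⟨extTop_injective h.1.1, h.1.2⟩, rfl⟩
  · intro π _
    rw [sign_extTop]

open Classical in
theorem sum_once_split (a l k : ℕ) :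
    ∑ π ∈ onceInvolutions (a + (l + a)) k with TopAt a π ∧ Split a π, χ (Perm.sign π) =
      χ (-1) ^ a * (avoidersTop a k).card * onceWeight χ l k := by
  have : χ (-1) ^ a * (avoidersTop a k).card * onceWeight χ l k =
      ∑ p ∈ avoidersTop a k ×ˢ onceInvolutions l k, χ (-1) ^ a * χ (Perm.sign p.2) := by
    rw [Finset.sum_product, onceWeight]
    simp only [← Finset.mul_sum, Finset.sum_const, nsmul_eq_mul]
    ring
  rw [this]
  symm
  refine Finset.sum_bij (fun p _ => sandwich p.1 p.2) ?_ ?_ ?_ ?_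
  · rintro ⟨ρ, σ⟩ h
    rw [mem_product, mem_avoidersTop, mem_onceInvolutions] at h
    obtain ⟨⟨⟨h1, h2⟩, h3⟩, h4, h5, h6⟩ := h
    rw [mem_filter, mem_onceInvolutions, inv_sandwich, lisLt_sandwich, card_occ132_sandwich]
    simp only at h1 h4 h5 ⊢
    rw [h4, h1, h5]
    exact ⟨⟨rfl, rfl, h2, h6⟩, (topAt_skewSum _ _).2 h3, split_skewSum _ _⟩
  · rintro ⟨ρ, σ⟩ _ ⟨ρ', σ'⟩ _ h
    exact Prod.ext_iff.2 (sandwich_injective h)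
  · intro π h
    rw [mem_filter, mem_onceInvolutions] at h
    obtain ⟨⟨h1, h2, h3⟩, h4, h5⟩ := h
    obtain ⟨ρ, σ, hσ, rfl⟩ := exists_sandwich h1 h5
    rw [lisLt_sandwich] at h3
    rw [card_occ132_sandwich] at h2
    refine ⟨(ρ, σ), ?_, rfl⟩
    rw [mem_product, mem_avoidersTop, mem_onceInvolutions]
    have h0 : (occ132 ρ).card = 0 := by omega
    refine ⟨⟨⟨Finset.card_eq_zero.1 h0, h3.1⟩, (topAt_skewSum _ _).1 h4⟩, hσ, ?_, h3.2⟩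
    simp only
    omega
  · rintro ⟨ρ, σ⟩ _
    rw [sign_sandwich, map_mul, map_pow]

open Classical in
theorem sum_once_not_split (m k : ℕ) (hk : 3 ≤ k) :
    ∑ π ∈ onceInvolutions (m + 1 + (1 + (m + 1))) k with TopAt (m + 2) π ∧ ¬ Split (m + 2) π,
      χ (Perm.sign π) = χ (-1) ^ (m + 1) * (avoidersTop (m + 1) k).card := by
  rw [mul_comm, ← nsmul_eq_mul, ← Finset.sum_const]
  symm
  refine Finset.sum_bij (fun ρ _ => pivotGlue ρ) ?_ (fun _ _ _ _ h => pivotGlue_injective h) ?_ ?_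
  · intro ρ h
    obtain ⟨⟨h1, h2⟩, h3⟩ := mem_avoidersTop.1 h
    rw [mem_filter, mem_onceInvolutions, card_occ132_pivotGlue h3, lisLt_pivotGlue h3 hk]
    exact ⟨⟨inv_pivotGlue ρ, h1, h2⟩, topAt_pivotGlue h3, not_split_pivotGlue h3⟩
  · intro π h
    rw [mem_filter, mem_onceInvolutions] at h
    obtain ⟨⟨h1, h2, h3⟩, h4, h5⟩ := h
    obtain ⟨ρ, hρ, rfl⟩ := exists_pivotGlue h1 h2 h4 h5
    rw [card_occ132_pivotGlue hρ] at h2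
    rw [lisLt_pivotGlue hρ hk] at h3
    exact ⟨ρ, mem_avoidersTop.2 ⟨⟨h2, h3⟩, hρ⟩, rfl⟩
  · intro ρ _
    rw [sign_pivotGlue, map_pow]

theorem onceWeight_succ (n k : ℕ) (hk : 2 ≤ k) :
    onceWeight χ (n + 1) (k + 1) = onceWeight χ n k +
      (∑ a ∈ range (n + 1), if 2 * a + 2 ≤ n + 1 then
        χ (-1) ^ (a + 1) * (avoiders a k).card * onceWeight χ (n + 1 - (2 * a + 2)) (k + 1)
        else 0) +
      ∑ m ∈ range (n + 1), if 2 * m + 3 = n + 1 then χ (-1) ^ (m + 1) * (avoiders m k).card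
        else 0 := by
  classical
  have h0 : ∑ π ∈ onceInvolutions (n + 1) (k + 1) with TopAt 0 π, χ (Perm.sign π) = 0 := by
    rw [Finset.filter_false_of_mem, Finset.sum_empty]
    rintro π - ⟨i, hi, -⟩
    omega
  rw [onceWeight, sum_eq_sum_topAt, Finset.sum_range_succ, sum_once_topAt_last,
    Finset.sum_range_succ', h0, add_zero, add_comm _ (onceWeight χ n k), add_assoc]
  congr 1
  -- The maximum is at position `a + 1`. The second term is the non-split case with `a = m + 1`, so
  -- `2 * a + 1` stands for `2 * m + 3`; `a = 0` contributes nothing because `avoidersTop 0` is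
  -- empty.
  have h1 : ∀ a ∈ range n,
      ∑ π ∈ onceInvolutions (n + 1) (k + 1) with TopAt (a + 1) π, χ (Perm.sign π) =
      (if 2 * a + 2 ≤ n + 1 then
        χ (-1) ^ (a + 1) * (avoiders a k).card * onceWeight χ (n + 1 - (2 * a + 2)) (k + 1)
        else 0) +
      if 2 * a + 1 = n + 1 then χ (-1) ^ a * (avoidersTop a (k + 1)).card else 0 := by
    intro a ha
    rw [mem_range] at ha
    rw [← Finset.sum_filter_add_sum_filter_not _ (Split (a + 1)), Finset.filter_filter,
      Finset.filter_filter]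
    congr 1
    · split_ifs with h
      · obtain ⟨l, hl⟩ : ∃ l, n + 1 = (a + 1) + (l + (a + 1)) := ⟨n + 1 - (2 * a + 2), by omega⟩
        rw [hl, sum_once_split, card_avoidersTop_succ]
        congr 2
        omega
      · rw [Finset.filter_false_of_mem, Finset.sum_empty]
        rintro π hπ ⟨h1, h2⟩
        have := h1.two_mul_le (mem_onceInvolutions.1 hπ).1 (by omega) h2
        omega
    · by_cases h : ∃ m, n + 1 = m + 1 + (1 + (m + 1)) ∧ a = m + 1
      · obtain ⟨m, hm, rfl⟩ := h
        rw [hm, sum_once_not_split χ m _ (by omega), if_pos (by omega)]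
      · rw [Finset.filter_false_of_mem, Finset.sum_empty]
        · split_ifs with h'
          · obtain rfl : a = 0 := by
              by_contra h0
              exact h ⟨a - 1, by omega, by omega⟩
            simp [avoidersTop_zero]
          · rfl
        · rintro π hπ ⟨h1, h2⟩
          have hπ' := mem_onceInvolutions.1 hπ
          obtain ⟨m, -, -, -, h3, h4, -⟩ := h1.not_split hπ'.1 hπ'.2.1 h2
          exact h ⟨m, h3, by omega⟩
  rw [Finset.sum_congr rfl h1, Finset.sum_add_distrib]
  congr 1
  · rw [Finset.sum_range_succ]
    split_ifs with h
    · omega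
    · simp
  · rcases n with _ | n
    · simp
    · rw [Finset.sum_range_succ', Finset.sum_range_succ _ (n + 1), Finset.sum_range_succ _ n,
        if_neg (by omega), if_neg (by omega), if_neg (by omega), add_zero, add_zero, add_zero]
      refine Finset.sum_congr rfl fun m _ => ?_
      rw [card_avoidersTop_succ]
      exact if_congr (by omega) rfl rfl

end

/-! ### Generating functions -/

theorem coeff_expand_two_mul {R : Type*} [CommRing R] (f g : R⟦X⟧) {N M : ℕ} (h : N < 2 * M) :
    PowerSeries.coeff N (PowerSeries.expand 2 two_ne_zero f * g) =
      ∑ a ∈ range M, if 2 * a ≤ N then PowerSeries.coeff a f * PowerSeries.coeff (N - 2 * a) g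
        else 0 := by
  rw [PowerSeries.coeff_mul, Finset.Nat.sum_antidiagonal_eq_sum_range_succ_mk,
    ← Finset.sum_filter]
  symm
  refine Finset.sum_of_injOn (fun a => 2 * a) ?_ ?_ ?_ ?_
  · intro a _ b _ hab
    simpa using hab
  · intro a ha
    simp only [coe_filter, Set.mem_ofPred_eq] at ha
    simp only [coe_range, Set.mem_Iio]
    omega
  · intro q hq hn
    rw [PowerSeries.coeff_expand_of_not_dvd, zero_mul]
    rintro ⟨a, rfl⟩
    refine hn ⟨a, ?_, rfl⟩
    rw [mem_range] at hq
    simp only [coe_filter, Set.mem_ofPred_eq, mem_range]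
    omega
  · intro a _
    rw [PowerSeries.coeff_expand_mul]

/-- The generating function of the permutations that avoid `132` and have no increasing
subsequence of length `k`. -/
noncomputable def avoidersGF (k : ℕ) : ℂ⟦X⟧ :=
  PowerSeries.mk fun n => ((avoiders n k).card : ℂ)

theorem avoidersGF_zero : avoidersGF 0 = 0 := by
  ext n
  simp [avoidersGF, avoiders_lis_zero]

theorem avoidersGF_succ (k : ℕ) :
    avoidersGF (k + 1) = 1 + PowerSeries.X * (avoidersGF k * avoidersGF (k + 1)) := by
  ext n
  rcases n with _ | n
  · simp [avoidersGF, card_avoiders_zero]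
  · rw [map_add, PowerSeries.coeff_succ_X_mul, PowerSeries.coeff_mul, PowerSeries.coeff_one,
      if_neg n.succ_ne_zero, zero_add]
    simp only [avoidersGF, PowerSeries.coeff_mk, card_avoiders_succ]
    push_cast
    rfl

section
variable (χ : ℤˣ →* ℂ)

/-- The generating function `avoidersGF k` at `χ (-1) * X ^ 2`. -/
noncomputable def twistedGF (k : ℕ) : ℂ⟦X⟧ :=
  PowerSeries.expand 2 two_ne_zero (PowerSeries.rescale (χ (-1)) (avoidersGF k))

theorem twistedGF_zero : twistedGF χ 0 = 0 := by
  rw [twistedGF, avoidersGF_zero, map_zero, map_zero]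

theorem twistedGF_succ (k : ℕ) : twistedGF χ (k + 1) =
    1 + PowerSeries.C (χ (-1)) * PowerSeries.X ^ 2 * twistedGF χ k * twistedGF χ (k + 1) := by
  conv_lhs => rw [twistedGF, avoidersGF_succ]
  simp only [map_add, map_mul, map_one, PowerSeries.rescale_X, PowerSeries.expand_C,
    PowerSeries.expand_X, twistedGF]
  ring

/-- The generating function of `onceWeight`. -/
noncomputable def onceGF (k : ℕ) : ℂ⟦X⟧ :=
  PowerSeries.mk fun n => onceWeight χ n k

theorem onceGF_two : onceGF χ 2 = 0 := by
  ext n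
  simp [onceGF, onceWeight, onceInvolutions_two]

theorem onceWeight_zero (k : ℕ) : onceWeight χ 0 k = 0 := by
  refine Finset.sum_eq_zero fun π h => ?_
  have := (mem_onceInvolutions.1 h).2.1
  rw [Finset.eq_empty_of_isEmpty (occ132 π)] at this
  simp at this

theorem onceGF_succ {k : ℕ} (hk : 2 ≤ k) : onceGF χ (k + 1) =
    PowerSeries.X * onceGF χ k +
      PowerSeries.C (χ (-1)) * (PowerSeries.X ^ 2 * (twistedGF χ k * onceGF χ (k + 1))) +
      PowerSeries.C (χ (-1)) * (PowerSeries.X ^ 3 * twistedGF χ k) := by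
  ext n
  rcases n with _ | n
  · simp [onceGF, onceWeight_zero]
  -- The lone factor `twistedGF χ k` is written as a product with 1, so that `coeff_expand_two_mul`
  -- applies to both terms.
  · rw [map_add, map_add, PowerSeries.coeff_succ_X_mul, PowerSeries.coeff_C_mul,
      PowerSeries.coeff_C_mul, PowerSeries.coeff_X_pow_mul', PowerSeries.coeff_X_pow_mul',
      ← mul_one (twistedGF χ k), mul_assoc, one_mul]
    simp only [twistedGF]
    rw [coeff_expand_two_mul _ _ (M := n + 1) (by omega),
      coeff_expand_two_mul _ _ (M := n + 1) (by omega)]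
    simp only [onceGF, PowerSeries.coeff_mk, PowerSeries.coeff_rescale, avoidersGF,
      PowerSeries.coeff_one]
    rw [onceWeight_succ χ n k hk]
    congr 1
    · congr 1
      split_ifs with h
      · rw [Finset.mul_sum]
        refine Finset.sum_congr rfl fun a _ => ?_
        rw [mul_ite, mul_zero]
        refine if_congr (by omega) ?_ rfl
        rw [show n + 1 - 2 - 2 * a = n + 1 - (2 * a + 2) by omega]
        ring
      · rw [mul_zero]
        exact Finset.sum_eq_zero fun a _ => if_neg (by omega)
    · split_ifs with h
      · rw [Finset.mul_sum]
        refine Finset.sum_congr rfl fun a _ => ?_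
        by_cases h1 : 2 * a + 3 = n + 1
        · rw [if_pos h1, if_pos (by omega), if_pos (by omega)]
          ring
        · rw [if_neg h1]
          split_ifs with h2 h3
          · omega
          · ring
          · ring
      · rw [mul_zero]
        exact Finset.sum_eq_zero fun a _ => if_neg (by omega)

end

/-- The inclusion of `ℤˣ` into `ℂ`. -/
noncomputable def signChar : ℤˣ →* ℂ :=
  (Int.castRingHom ℂ : ℤ →* ℂ).comp (Units.coeHom ℤ)

theorem signChar_neg_one : signChar (-1) = -1 := by simp [signChar]

/-- Half the sum of the trivial and the sign character is the indicator of even permutations. -/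
theorem genJe_increasingPattern (k : ℕ) : genJe (increasingPattern k) =
    PowerSeries.C (1 / 2) * (onceGF 1 k + onceGF signChar k) := by
  classical
  ext n
  have hset : evenInvolutionsOnce132 (increasingPattern k) n =
      ({π ∈ onceInvolutions n k | Perm.sign π = 1} : Finset _) := by
    ext π
    simp only [evenInvolutionsOnce132, Set.mem_ofPred_eq, ncard_occurrences_pattern132,
      avoids_increasingPattern_iff, isEvenPerm_iff, coe_filter, mem_onceInvolutions]
    tauto
  rw [genJe, PowerSeries.coeff_mk, hset, Set.ncard_coe_finset, Finset.card_filter,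
    PowerSeries.coeff_C_mul, map_add, onceGF, onceGF, PowerSeries.coeff_mk, PowerSeries.coeff_mk,
    onceWeight, onceWeight, ← Finset.sum_add_distrib, Finset.mul_sum]
  push_cast
  refine Finset.sum_congr rfl fun π _ => ?_
  rcases Int.units_eq_one_or (Perm.sign π) with h | h
  · rw [h, map_one, map_one]
    norm_num
  · rw [h, signChar_neg_one]
    simp

/-! ### Chebyshev polynomials -/

section
variable {K : Type*} [Field K]

theorem chebU_zero (t : K) : chebU 0 t = 1 := by simp [chebU]

theorem chebU_one (t : K) : chebU 1 t = 2 * t := by simp [chebU]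

theorem chebU_add_two (r : ℕ) (t : K) :
    chebU (r + 2) t = 2 * t * chebU (r + 1) t - chebU r t := by
  have := Polynomial.Chebyshev.U_add_two K (r : ℤ)
  simp only [chebU]
  push_cast
  rw [this]
  simp

theorem chebQuotient_zero (s : K) : chebQuotient 0 s = 0 := by simp [chebQuotient]

theorem chebQuotient_succ (k : ℕ) (s : K) : chebQuotient (k + 1) s =
    chebU k (1 / (2 * s)) / (s * chebU (k + 1) (1 / (2 * s))) := by
  simp [chebQuotient, chebU]

/-- With `t = 1 / (2 * s)`, the recurrence for `D` is equivalent to `D (k+1) * s * U_{k+1}(t) =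
U_k(t)`. The same identity carries nonvanishing of `U_k(t)` to the next index, so both claims are
proved together. -/
theorem chebQuotient_eq [NeZero (2 : K)] {s : K} (hs : s ≠ 0) {D : ℕ → K} (h0 : D 0 = 0)
    (h : ∀ k, D (k + 1) = 1 + s ^ 2 * D k * D (k + 1)) (k : ℕ) :
    chebU k (1 / (2 * s)) ≠ 0 ∧ chebQuotient k s = D k := by
  have h2 : (2 : K) ≠ 0 := NeZero.ne 2
  induction k with
  | zero => rw [chebU_zero, chebQuotient_zero, h0]; simp
  | succ k ih =>
    obtain ⟨hU, hD⟩ := ih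
    have key : D (k + 1) * (s * chebU (k + 1) (1 / (2 * s))) = chebU k (1 / (2 * s)) := by
      rcases k with _ | k
      · rw [h 0, h0, zero_add, chebU_one, chebU_zero]
        field_simp
        ring
      · rw [chebQuotient_succ] at hD
        have hk := h (k + 1)
        rw [← hD] at hk
        rw [chebU_add_two]
        generalize chebU (k + 1) (1 / (2 * s)) = u at *
        generalize chebU k (1 / (2 * s)) = v at *
        generalize D (k + 1 + 1) = d at *
        field_simp at hk ⊢
        linear_combination hk
    have hU' : chebU (k + 1) (1 / (2 * s)) ≠ 0 := by
      intro h0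
      rw [h0, mul_zero, mul_zero] at key
      exact hU key.symm
    refine ⟨hU', ?_⟩
    rw [chebQuotient_succ, ← key, mul_div_cancel_right₀ _ (mul_ne_zero hs hU')]

/-- Substituting `P k = U_{k-1} / (x U_k)` gives `A (k+1) U_{k+1} = A k U_k + x U_{k-1}`, which
telescopes. -/
theorem mul_chebU_eq_sum [NeZero (2 : K)] {x : K} (hx : x ≠ 0) {P A : ℕ → K} (hP0 : P 0 = 0)
    (hP : ∀ k, P (k + 1) = 1 + x ^ 2 * P k * P (k + 1)) (hA2 : A 2 = 0)
    (hA : ∀ k, 2 ≤ k → A (k + 1) = P (k + 1) * (x * A k + x ^ 3 * P k)) {k : ℕ} (hk : 2 ≤ k) :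
    A k * chebU k (1 / (2 * x)) = x * ∑ i ∈ Icc 1 (k - 2), chebU i (1 / (2 * x)) := by
  induction k, hk using Nat.le_induction with
  | base => simp [hA2]
  | succ k hk ih =>
    obtain ⟨k, rfl⟩ := Nat.exists_eq_add_of_le' hk
    have h1 := chebQuotient_eq hx hP0 hP (k + 1)
    have h2 := chebQuotient_eq hx hP0 hP (k + 2)
    have h3 := chebQuotient_eq hx hP0 hP (k + 3)
    rw [show k + 2 + 1 - 2 = k + 1 by omega, Finset.sum_Icc_succ_top (by omega), mul_add]
    rw [show k + 2 - 2 = k by omega] at ih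
    rw [← ih, hA _ hk, ← h2.2, ← h3.2, chebQuotient_succ, chebQuotient_succ]
    have h1 := h1.1
    have h2 := h2.1
    have h3 := h3.1
    rw [show k + 2 + 1 = k + 3 from rfl]
    rw [show k + 1 + 1 = k + 2 from rfl]
    field_simp

/-- Since `M (k+1) (1 + x² M k) = 1`, the recurrence for `A` can be rewritten as `A (k+1) = M (k+1)
(x A k + x³ P k + x² (P k + M k) A (k+1))`. It now has the same outer factor as the one for `B`, and
the `A (k+1)` left inside is replaced by its Chebyshev sum. -/
theorem average_recurrence [NeZero (2 : K)] {x : K} (hx : x ≠ 0) {P M A B : ℕ → K}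
    (hP0 : P 0 = 0) (hP : ∀ k, P (k + 1) = 1 + x ^ 2 * P k * P (k + 1))
    (hM : ∀ k, M (k + 1) = 1 - x ^ 2 * M k * M (k + 1)) (hA2 : A 2 = 0)
    (hA : ∀ k, 2 ≤ k → A (k + 1) = P (k + 1) * (x * A k + x ^ 3 * P k))
    (hB : ∀ k, 2 ≤ k → B (k + 1) = M (k + 1) * (x * B k - x ^ 3 * M k)) {k : ℕ} (hk : 2 ≤ k) :
    1 / 2 * (A (k + 1) + B (k + 1)) = M (k + 1) * (x * (1 / 2 * (A k + B k)) +
      x ^ 3 * (1 / 2 * (P k - M k) + 1 / 2 * (P k + M k) / chebU (k + 1) (1 / (2 * x)) *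
        ∑ i ∈ Icc 1 (k - 1), chebU i (1 / (2 * x)))) := by
  have h1 := (chebQuotient_eq hx hP0 hP (k + 1)).1
  have h2 := mul_chebU_eq_sum hx hP0 hP hA2 hA (k := k + 1) (by omega)
  rw [show k + 1 - 2 = k - 1 by omega] at h2
  have h3 : 1 / 2 * (P k + M k) / chebU (k + 1) (1 / (2 * x)) *
      ∑ i ∈ Icc 1 (k - 1), chebU i (1 / (2 * x)) = 1 / 2 * (P k + M k) * (A (k + 1) / x) := by
    field_simp
    linear_combination (-(P k + M k)) * h2
  rw [h3, hB k hk]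
  have hA' := hA k hk
  have hP' := hP k
  have hM' := hM k
  have h2 : (2 : K) ≠ 0 := NeZero.ne 2
  generalize A (k + 1) = a at *
  generalize P (k + 1) = p at *
  generalize M (k + 1) = m at *
  have key : x * A k + x ^ 3 * P k = a * (1 - x ^ 2 * P k) := by
    rw [hA']
    linear_combination (-(x * A k + x ^ 3 * P k)) * hP'
  field_simp
  linear_combination (-m) * key - a * hM'

end

/-! ### Laurent series and the final formula. -/

theorem laurentX_ne_zero : laurentX ≠ 0 := by
  rw [laurentX, Ne, ← PowerSeries.coe_zero]
  exact fun h => PowerSeries.X_ne_zero (HahnSeries.ofPowerSeries_injective h)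

section
variable (χ : ℤˣ →* ℂ)

/-- The weight `χ (-1)` as a Laurent series. -/
noncomputable def laurentSign : LaurentSeries ℂ := HahnSeries.C (χ (-1))

theorem coe_twistedGF_succ (k : ℕ) : (twistedGF χ (k + 1) : LaurentSeries ℂ) =
    1 + laurentSign χ * laurentX ^ 2 * twistedGF χ k * twistedGF χ (k + 1) := by
  have h := congrArg (fun f : ℂ⟦X⟧ => (f : LaurentSeries ℂ)) (twistedGF_succ χ k)
  simp only [PowerSeries.coe_add, PowerSeries.coe_mul, PowerSeries.coe_pow, PowerSeries.coe_C,
    PowerSeries.coe_one] at h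
  exact h

/-- The equation for `D'` says that `D'` is the inverse of `1 - s x² D`, the coefficient of `A'` in
the linear equation. -/
theorem eq_mul_of_linear {K : Type*} [Field K] {x s D D' A A' : K}
    (hA : A' = x * A + s * (x ^ 2 * (D * A')) + s * (x ^ 3 * D))
    (hD : D' = 1 + s * x ^ 2 * D * D') : A' = D' * (x * A + s * x ^ 3 * D) := by
  linear_combination D' * hA - A' * hD

theorem coe_onceGF_succ {k : ℕ} (hk : 2 ≤ k) : (onceGF χ (k + 1) : LaurentSeries ℂ) =
    twistedGF χ (k + 1) *
      (laurentX * onceGF χ k + laurentSign χ * laurentX ^ 3 * twistedGF χ k) := by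
  have h := congrArg (fun f : ℂ⟦X⟧ => (f : LaurentSeries ℂ)) (onceGF_succ χ hk)
  simp only [PowerSeries.coe_add, PowerSeries.coe_mul, PowerSeries.coe_pow,
    PowerSeries.coe_C] at h
  exact eq_mul_of_linear h (coe_twistedGF_succ χ k)

end

theorem laurentSign_one : laurentSign 1 = 1 := by
  rw [laurentSign, MonoidHom.one_apply, map_one]

theorem laurentSign_signChar : laurentSign signChar = -1 := by
  rw [laurentSign, signChar_neg_one, map_neg, map_one]

instance : NeZero (2 : LaurentSeries ℂ) := by
  refine ⟨?_⟩
  rw [← map_ofNat (HahnSeries.C : ℂ →+* LaurentSeries ℂ) 2]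
  exact (map_ne_zero _).2 two_ne_zero

theorem chebR_laurentX_sq (k : ℕ) : chebR k (laurentX ^ 2) = (twistedGF 1 k : LaurentSeries ℂ) := by
  rw [chebR_sq]
  refine (chebQuotient_eq laurentX_ne_zero (D := fun k => (twistedGF 1 k : LaurentSeries ℂ))
    ?_ (fun k => ?_) k).2
  · rw [twistedGF_zero, PowerSeries.coe_zero]
  · simpa only [laurentSign_one, one_mul] using coe_twistedGF_succ 1 k

theorem chebR_neg_laurentX_sq (k : ℕ) :
    chebR k (-laurentX ^ 2) = (twistedGF signChar k : LaurentSeries ℂ) := by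
  rw [neg_laurentX_sq, chebR_sq]
  refine (chebQuotient_eq (mul_ne_zero ((map_ne_zero _).2 Complex.I_ne_zero) laurentX_ne_zero)
    (D := fun k => (twistedGF signChar k : LaurentSeries ℂ)) ?_ (fun k => ?_) k).2
  · rw [twistedGF_zero, PowerSeries.coe_zero]
  · rw [← neg_laurentX_sq]
    have h := coe_twistedGF_succ signChar k
    rw [laurentSign_signChar] at h
    linear_combination h

theorem coe_genJe (k : ℕ) :
    ((genJe (increasingPattern k) : ℂ⟦X⟧) : LaurentSeries ℂ) =
      1 / 2 * ((onceGF 1 k : LaurentSeries ℂ) + (onceGF signChar k : LaurentSeries ℂ)) := by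
  rw [genJe_increasingPattern, PowerSeries.coe_mul, PowerSeries.coe_add, PowerSeries.coe_C,
    map_div₀, map_one, map_ofNat]

theorem coe_genJe_succ {k : ℕ} (hk : 2 ≤ k) :
    ((genJe (increasingPattern (k + 1)) : ℂ⟦X⟧) : LaurentSeries ℂ) =
      chebR (k + 1) (-laurentX ^ 2) * (laurentX * (genJe (increasingPattern k) : ℂ⟦X⟧) +
        laurentX ^ 3 * (chebRo k (laurentX ^ 2) +
          chebRe k (laurentX ^ 2) / chebU (k + 1) (1 / (2 * laurentX)) *
            ∑ i ∈ Icc 1 (k - 1), chebU i (1 / (2 * laurentX)))) := by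
  rw [coe_genJe, coe_genJe, chebRo, chebRe, chebR_laurentX_sq, chebR_neg_laurentX_sq,
    chebR_neg_laurentX_sq]
  refine average_recurrence (A := fun k => (onceGF 1 k : LaurentSeries ℂ))
    (B := fun k => (onceGF signChar k : LaurentSeries ℂ))
    (P := fun k => (twistedGF 1 k : LaurentSeries ℂ))
    (M := fun k => (twistedGF signChar k : LaurentSeries ℂ))
    laurentX_ne_zero ?_ (fun k => ?_) (fun k => ?_) ?_ (fun k hk => ?_) (fun k hk => ?_) hk
  · rw [twistedGF_zero, PowerSeries.coe_zero]
  · simpa only [laurentSign_one, one_mul] using coe_twistedGF_succ 1 k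
  · have h := coe_twistedGF_succ signChar k
    rw [laurentSign_signChar] at h
    linear_combination h
  · rw [onceGF_two, PowerSeries.coe_zero]
  · simpa only [laurentSign_one, one_mul] using coe_onceGF_succ 1 hk
  · have h := coe_onceGF_succ signChar hk
    rw [laurentSign_signChar] at h
    linear_combination h

theorem mainTheorem10 (k : ℕ) (hk : 2 ≤ k) :
    ((genJe (increasingPattern k) : ℂ⟦X⟧) : LaurentSeries ℂ) =
      ∑ j ∈ Finset.Icc 3 k,
        laurentX ^ (k + 3 - j) *
          (chebRo (j - 1) (laurentX ^ 2) +
            chebRe (j - 1) (laurentX ^ 2) / chebU j (1 / (2 * laurentX)) *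
              ∑ i ∈ Finset.Icc 1 (j - 2), chebU i (1 / (2 * laurentX))) *
          ∏ i ∈ Finset.Icc j k, chebR i (-laurentX ^ 2) := by
  induction k, hk using Nat.le_induction with
  | base =>
    rw [coe_genJe, onceGF_two, onceGF_two]
    simp
  | succ k hk ih =>
    -- Each old term gains the factor `x R_{k+1}(-x²)`; the inhomogeneous part is the new term `j =
    -- k + 1`, with power `x³`.
    rw [coe_genJe_succ hk, ih, Finset.sum_Icc_succ_top (by omega), Finset.Icc_self,
      Finset.prod_singleton, mul_add, Nat.add_sub_cancel_left, Nat.add_sub_cancel,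
      show k + 1 - 2 = k - 1 by omega, Finset.mul_sum, Finset.mul_sum]
    congr 1
    · refine Finset.sum_congr rfl fun j hj => ?_
      rw [mem_Icc] at hj
      rw [Finset.prod_Icc_succ_top (by omega),
        show k + 1 + 3 - j = (k + 3 - j) + 1 by omega, pow_succ]
      ring
    · ring
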